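/- Manifolds are smooth, finite-dimensional, without boundary, Hausdorff and second countable. Let $\Gamma\rightrightarrows\Gamma_0$ be a Lie groupoid with target $\alpha$ and source $\beta$ (so $\gamma_1\gamma_2$ is defined when $\beta(\gamma_1)=\alpha(\gamma_2)$), and let $G$ be a Lie group. Then the following three categories are equivalent. (1) The category of principal $G$-bundles over $\Gamma\rightrightarrows\Gamma_0$. An object is a (locally trivial) principal right $G$-bundle $\pi:P\to\Gamma_0$ with a smooth left action $\Gamma\times_{\beta,\Gamma_0,\pi}P\to P$, $(\gamma,p)\mapsto\gamma\cdot p$, such that $\pi(\gamma\cdot p)=\alpha(\gamma)$, units act trivially, $\gamma_1\cdot(\gamma_2\cdot p)=(\gamma_1\gamma_2)\cdot p$, and $(\gamma\cdot p)\cdot g=\gamma\cdot(p\cdot g)$, whenever these are defined. A morphism is a smooth $G$- and $\Gamma$-equivariant map over $\Gamma_0$. (2) The category of principal $G$-bundles over the simplicial manifold $\Gamma_\bullet$, the nerve of $\Gamma$, whose $n$-simplices are the composable $n$-tuples $(\gamma_1,\dots,\gamma_n)$, $\beta(\gamma_i)=\alpha(\gamma_{i+1})$ (the points of $\Gamma_0$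 for $n=0$). An object is a simplicial manifold $P_\bullet$ over $\Gamma_\bullet$ such that each $P_n\to\Gamma_n$ is a principal $G$-bundle and all face and degeneracy maps are morphisms of principal $G$-bundles. A morphism is a simplicial smooth $G$-equivariant map over $\Gamma_\bullet$. (3) The category of generalized homomorphisms from $\Gamma\rightrightarrows\Gamma_0$ to $H\rightrightarrows H_0$, where $H\rightrightarrows H_0$ is $G\rightrightarrows\mathrm{pt}$. An object is a manifold $Z$ with smooth maps $\Gamma_0\xleftarrow{\tau}Z\xrightarrow{\sigma}H_0$, a smooth left action of $\Gamma$ along $\tau$ and a smooth right action of $H$ along $\sigma$, such that the actions commute ($\sigma$ is $\Gamma$-invariant, $\tau$ is $H$-invariant, and $(\gamma\cdot z)\cdot h=\gamma\cdot(z\cdot h)$) and $Z$ is an $H$-principal bundle over $\Gamma_0$: $\tau$ is a surjective submersion, and for all $z,z'\in Z$ with $\tau(z)=\tau(z')$ there is a unique $h\in H$ such that $z\cdot h$ is defined and equals $z'$. A morphism is a smooth map over $\Gamma_0$ and $H_0$ that is $\Gamma$- and $H$-equivariant. -/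

import Mathlib

open scoped Manifold ContDiff
open CategoryTheory

universe u

noncomputable section

namespace LieGroupoids

/-- A smooth manifold: finite-dimensional, without boundary, Hausdorff and second countable. -/
structure Mfd : Type (u + 1) where
  carrier : Type u
  dim : ℕ
  [top : TopologicalSpace carrier]
  [charted : ChartedSpace (EuclideanSpace ℝ (Fin dim)) carrier]
  [smooth : IsManifold (𝓡 dim) ∞ carrier]
  [hausdorff : T2Space carrier]
  [countable : SecondCountableTopology carrier]

namespace Mfd

instance : CoeSort Mfd.{u} (Type u) := ⟨Mfd.carrier⟩

attribute [instance] Mfd.top Mfd.charted Mfd.smooth Mfd.hausdorff Mfd.countable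

/-- Smooth maps between manifolds. -/
abbrev Smooth {M N : Mfd.{u}} (f : M → N) : Prop := ContMDiff (𝓡 M.dim) (𝓡 N.dim) ∞ f

/-- Submersions between manifolds. -/
abbrev Submersion {M N : Mfd.{u}} (f : M → N) : Prop :=
  Manifold.IsSubmersion (𝓡 M.dim) (𝓡 N.dim) ∞ f

/-- The category of smooth manifolds and smooth maps. -/
instance : Category Mfd.{u} where
  Hom M N := {f : M → N // Smooth f}
  id M := ⟨id, contMDiff_id⟩
  comp f g := ⟨g.1 ∘ f.1, g.2.comp f.2⟩

section FiberProduct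

variable {M N B : Mfd.{u}} {f : M → B} {g : N → B}

/-- The set underlying the fibre product `M ×_B N`. -/
abbrev FP (f : M → B) (g : N → B) : Type u := {q : M × N // f q.1 = g q.2}

lemma exists_fpModel (hg : Submersion g) (q : FP f g) :
    Nonempty ((EuclideanSpace ℝ (Fin M.dim) × hg.complement) ≃L[ℝ]
      EuclideanSpace ℝ (Fin (M.dim + (N.dim - B.dim)))) := by
  have h := hg.isSubmersionOfComplement_complement q.1.2
  have L := h.equiv
  have : FiniteDimensional ℝ hg.complement := by
    have : FiniteDimensional ℝ (EuclideanSpace ℝ (Fin B.dim) × hg.complement) :=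
      L.toLinearEquiv.finiteDimensional
    exact Module.Finite.of_surjective (LinearMap.snd ℝ (EuclideanSpace ℝ (Fin B.dim)) _)
      Prod.snd_surjective
  have e := L.toLinearEquiv.finrank_eq
  rw [Module.finrank_prod, finrank_euclideanSpace_fin, finrank_euclideanSpace_fin] at e
  refine ⟨ContinuousLinearEquiv.ofFinrankEq ?_⟩
  rw [Module.finrank_prod, finrank_euclideanSpace_fin, finrank_euclideanSpace_fin]
  omega

/-- An identification of the model space of the fibre product. -/
def fpModel (hg : Submersion g) (q : FP f g) :
    (EuclideanSpace ℝ (Fin M.dim) × hg.complement) ≃L[ℝ]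
      EuclideanSpace ℝ (Fin (M.dim + (N.dim - B.dim))) :=
  (exists_fpModel hg q).some

variable (hf : Smooth f) (hg : Submersion g) (q : FP f g)

/-- The domain chart of `N` around a point in which the submersion is a linear projection. -/
abbrev fpDom : OpenPartialHomeomorph N (EuclideanSpace ℝ (Fin N.dim)) :=
  (hg.isSubmersionOfComplement_complement q.1.2).domChart

/-- The chart of `B` around a point in which the submersion is a linear projection. -/
abbrev fpCod : OpenPartialHomeomorph B (EuclideanSpace ℝ (Fin B.dim)) :=
  (hg.isSubmersionOfComplement_complement q.1.2).codChart

/-- The splitting of the model space of `N` in which the submersion is the first projection. -/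
abbrev fpSplit : EuclideanSpace ℝ (Fin N.dim) ≃L[ℝ]
    EuclideanSpace ℝ (Fin B.dim) × hg.complement :=
  (hg.isSubmersionOfComplement_complement q.1.2).equiv

lemma fp_written {y : EuclideanSpace ℝ (Fin N.dim)} (hy : y ∈ (fpDom hg q).target) :
    fpCod hg q (g ((fpDom hg q).symm y)) = (fpSplit hg q y).1 := by
  have h := (hg.isSubmersionOfComplement_complement q.1.2).writtenInCharts
  have hy' : y ∈ ((fpDom hg q).extend (𝓡 N.dim)).target := by simpa using hy
  simpa using h hy'

lemma fp_maps {n : N} (hn : n ∈ (fpDom hg q).source) : g n ∈ (fpCod hg q).source :=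
  (hg.isSubmersionOfComplement_complement q.1.2).source_subset_preimage_source hn

/-- The chart of the fibre product, as a map on `M × N`. -/
def fpFwd (p : M × N) : EuclideanSpace ℝ (Fin (M.dim + (N.dim - B.dim))) :=
  fpModel hg q (chartAt (EuclideanSpace ℝ (Fin M.dim)) q.1.1 p.1, (fpSplit hg q (fpDom hg q p.2)).2)

/-- The inverse of the chart of the fibre product, as a map to `M × N`. -/
def fpBwd (x : EuclideanSpace ℝ (Fin (M.dim + (N.dim - B.dim)))) : M × N :=
  let m := (chartAt (EuclideanSpace ℝ (Fin M.dim)) q.1.1).symm ((fpModel hg q).symm x).1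
  (m, (fpDom hg q).symm ((fpSplit hg q).symm (fpCod hg q (f m), ((fpModel hg q).symm x).2)))

/-- The part of the model space on which the base point of a fibre lies in the chart of `B`. -/
def fpPre : Set (EuclideanSpace ℝ (Fin (M.dim + (N.dim - B.dim)))) :=
  {x | ((fpModel hg q).symm x).1 ∈ (chartAt (EuclideanSpace ℝ (Fin M.dim)) q.1.1).target ∧
    f ((chartAt (EuclideanSpace ℝ (Fin M.dim)) q.1.1).symm ((fpModel hg q).symm x).1) ∈
      (fpCod hg q).source}

/-- The target of the chart of the fibre product. -/
def fpTarget : Set (EuclideanSpace ℝ (Fin (M.dim + (N.dim - B.dim)))) :=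
  {x ∈ fpPre hg q | (fpSplit hg q).symm (fpCod hg q (f (fpBwd hg q x).1),
    ((fpModel hg q).symm x).2) ∈ (fpDom hg q).target}

lemma fpFwd_smooth : ContMDiffOn ((𝓡 M.dim).prod (𝓡 N.dim)) (𝓡 (M.dim + (N.dim - B.dim))) ∞
    (fpFwd hg q) ((chartAt (EuclideanSpace ℝ (Fin M.dim)) q.1.1).source ×ˢ
      (fpDom hg q).source) := by
  have h1 : ContMDiffOn ((𝓡 M.dim).prod (𝓡 N.dim)) 𝓘(ℝ, EuclideanSpace ℝ (Fin M.dim)) ∞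
      (fun p : M × N => chartAt (EuclideanSpace ℝ (Fin M.dim)) q.1.1 p.1)
      ((chartAt (EuclideanSpace ℝ (Fin M.dim)) q.1.1).source ×ˢ (fpDom hg q).source) :=
    (contMDiffOn_chart (I := 𝓡 M.dim)).comp contMDiff_fst.contMDiffOn (fun p hp => hp.1)
  have h2 : ContMDiffOn ((𝓡 M.dim).prod (𝓡 N.dim)) 𝓘(ℝ, EuclideanSpace ℝ (Fin N.dim)) ∞
      (fun p : M × N => fpDom hg q p.2)
      ((chartAt (EuclideanSpace ℝ (Fin M.dim)) q.1.1).source ×ˢ (fpDom hg q).source) :=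
    (contMDiffOn_of_mem_maximalAtlas
      (hg.isSubmersionOfComplement_complement q.1.2).domChart_mem_maximalAtlas).comp
      contMDiff_snd.contMDiffOn (fun p hp => hp.2)
  have h3 : ContMDiff 𝓘(ℝ, EuclideanSpace ℝ (Fin N.dim)) 𝓘(ℝ, hg.complement) ∞
      (fun y => (fpSplit hg q y).2) :=
    ((ContinuousLinearMap.snd ℝ _ _).comp (fpSplit hg q).toContinuousLinearMap).contMDiff
  exact (fpModel hg q).toContinuousLinearMap.contMDiff.comp_contMDiffOn
    (h1.prodMk_space (h3.comp_contMDiffOn h2))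

lemma fpFst_smooth : ContMDiffOn (𝓡 (M.dim + (N.dim - B.dim))) (𝓡 M.dim) ∞
    (fun x => (fpBwd (f := f) hg q x).1) (fpPre hg q) := by
  refine (contMDiffOn_chart_symm (I := 𝓡 M.dim)).comp
    (((ContinuousLinearMap.fst ℝ _ _).comp
      (fpModel hg q).symm.toContinuousLinearMap).contMDiff.contMDiffOn) (fun x hx => hx.1)

lemma fpBase_smooth (hf : Smooth f) (hg : Submersion g) (q : FP f g) :
    ContMDiffOn (𝓡 (M.dim + (N.dim - B.dim))) (𝓡 N.dim) ∞
    (fun x => (fpSplit hg q).symm (fpCod hg q (f (fpBwd hg q x).1), ((fpModel hg q).symm x).2))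
    (fpPre hg q) := by
  have h1 : ContMDiffOn (𝓡 (M.dim + (N.dim - B.dim))) 𝓘(ℝ, EuclideanSpace ℝ (Fin B.dim)) ∞
      (fun x => fpCod hg q (f (fpBwd hg q x).1)) (fpPre hg q) :=
    (contMDiffOn_of_mem_maximalAtlas
      (hg.isSubmersionOfComplement_complement q.1.2).codChart_mem_maximalAtlas).comp
      (hf.comp_contMDiffOn (fpFst_smooth hg q)) (fun x hx => hx.2)
  have h2 : ContMDiff (𝓡 (M.dim + (N.dim - B.dim))) 𝓘(ℝ, hg.complement) ∞
      (fun x => ((fpModel hg q).symm x).2) :=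
    ((ContinuousLinearMap.snd ℝ _ _).comp
      (fpModel hg q).symm.toContinuousLinearMap).contMDiff
  exact (fpSplit hg q).symm.toContinuousLinearMap.contMDiff.comp_contMDiffOn
    (h1.prodMk_space h2.contMDiffOn)

lemma fpBwd_smooth (hf : Smooth f) (hg : Submersion g) (q : FP f g) :
    ContMDiffOn (𝓡 (M.dim + (N.dim - B.dim))) ((𝓡 M.dim).prod (𝓡 N.dim)) ∞
    (fpBwd hg q) (fpTarget hg q) :=
  ((fpFst_smooth hg q).mono (fun _ hx => hx.1)).prodMk
    ((contMDiffOn_symm_of_mem_maximalAtlas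
      (hg.isSubmersionOfComplement_complement q.1.2).domChart_mem_maximalAtlas).comp
      ((fpBase_smooth hf hg q).mono (fun _ hx => hx.1)) (fun _ hx => hx.2))

lemma fpPre_open (hf : Smooth f) (hg : Submersion g) (q : FP f g) : IsOpen (fpPre hg q) := by
  have h0 : IsOpen {x | ((fpModel hg q).symm x).1 ∈
      (chartAt (EuclideanSpace ℝ (Fin M.dim)) q.1.1).target} :=
    (chartAt (EuclideanSpace ℝ (Fin M.dim)) q.1.1).open_target.preimage
      (continuous_fst.comp (fpModel hg q).symm.continuous)
  have h1 : ContinuousOn (fun x => f ((chartAt (EuclideanSpace ℝ (Fin M.dim)) q.1.1).symm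
      ((fpModel hg q).symm x).1)) {x | ((fpModel hg q).symm x).1 ∈
      (chartAt (EuclideanSpace ℝ (Fin M.dim)) q.1.1).target} :=
    hf.continuous.comp_continuousOn
      ((chartAt (EuclideanSpace ℝ (Fin M.dim)) q.1.1).continuousOn_symm.comp
        (continuous_fst.comp (fpModel hg q).symm.continuous).continuousOn (fun _ hx => hx))
  exact h1.isOpen_inter_preimage h0 (fpCod hg q).open_source

lemma fpTarget_open (hf : Smooth f) (hg : Submersion g) (q : FP f g) : IsOpen (fpTarget hg q) :=
  (fpBase_smooth hf hg q).continuousOn.isOpen_inter_preimage (fpPre_open hf hg q)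
    (fpDom hg q).open_target

lemma fpBwd_mem {x : EuclideanSpace ℝ (Fin (M.dim + (N.dim - B.dim)))}
    (hx : x ∈ fpTarget hg q) : f (fpBwd hg q x).1 = g (fpBwd hg q x).2 := by
  have h := fp_written hg q hx.2
  refine (fpCod hg q).injOn hx.1.2 (fp_maps hg q ((fpDom hg q).map_target hx.2)) ?_
  exact (h.trans (by rw [ContinuousLinearEquiv.apply_symm_apply]; rfl)).symm

open Classical in
/-- The chart of the fibre product around a point. -/
def fpChart : OpenPartialHomeomorph (FP f g)
    (EuclideanSpace ℝ (Fin (M.dim + (N.dim - B.dim)))) where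
  toFun p := fpFwd hg q p.1
  invFun x := if hx : x ∈ fpTarget hg q then ⟨fpBwd hg q x, fpBwd_mem hg q hx⟩ else q
  source := {p | p.1.1 ∈ (chartAt (EuclideanSpace ℝ (Fin M.dim)) q.1.1).source ∧
    p.1.2 ∈ (fpDom hg q).source}
  target := fpTarget hg q
  map_source' := by
    rintro ⟨⟨m, n⟩, h⟩ ⟨hm, hn⟩
    simp only at h hm hn
    have hc := fp_maps hg q hn
    have hw := fp_written hg q ((fpDom hg q).map_source hn)
    rw [(fpDom hg q).left_inv hn] at hw
    have e : (fpSplit hg q).symm (fpCod hg q (f m), (fpSplit hg q (fpDom hg q n)).2) =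
        fpDom hg q n := by
      rw [h, hw, Prod.mk.eta, ContinuousLinearEquiv.symm_apply_apply]
    refine ⟨⟨?_, ?_⟩, ?_⟩
    · simp [fpFwd, hm]
    · simpa [fpFwd, hm, h] using hc
    · simp only [fpFwd, fpBwd, ContinuousLinearEquiv.symm_apply_apply,
        (chartAt (EuclideanSpace ℝ (Fin M.dim)) q.1.1).left_inv hm, e]
      exact (fpDom hg q).map_source hn
  map_target' := by
    intro x hx
    rw [dif_pos hx]
    exact ⟨(chartAt (EuclideanSpace ℝ (Fin M.dim)) q.1.1).map_target hx.1.1,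
      (fpDom hg q).map_target hx.2⟩
  left_inv' := by
    rintro ⟨⟨m, n⟩, h⟩ ⟨hm, hn⟩
    simp only at h hm hn
    have hc := fp_maps hg q hn
    have hw := fp_written hg q ((fpDom hg q).map_source hn)
    rw [(fpDom hg q).left_inv hn] at hw
    have e : (fpSplit hg q).symm (fpCod hg q (f m), (fpSplit hg q (fpDom hg q n)).2) =
        fpDom hg q n := by
      rw [h, hw, Prod.mk.eta, ContinuousLinearEquiv.symm_apply_apply]
    have hx : fpFwd hg q (m, n) ∈ fpTarget hg q := by
      refine ⟨⟨?_, ?_⟩, ?_⟩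
      · simp [fpFwd, hm]
      · simpa [fpFwd, hm, h] using hc
      · simp only [fpFwd, fpBwd, ContinuousLinearEquiv.symm_apply_apply,
          (chartAt (EuclideanSpace ℝ (Fin M.dim)) q.1.1).left_inv hm, e]
        exact (fpDom hg q).map_source hn
    rw [dif_pos hx]
    apply Subtype.ext
    simp only [fpFwd, fpBwd, ContinuousLinearEquiv.symm_apply_apply,
      (chartAt (EuclideanSpace ℝ (Fin M.dim)) q.1.1).left_inv hm, e, (fpDom hg q).left_inv hn]
  right_inv' := by
    intro x hx
    rw [dif_pos hx]
    have h2 := (fpDom hg q).right_inv hx.2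
    simp only [fpBwd] at h2
    simp only [fpFwd, fpBwd]
    rw [h2, (chartAt (EuclideanSpace ℝ (Fin M.dim)) q.1.1).right_inv hx.1.1,
      ContinuousLinearEquiv.apply_symm_apply, Prod.mk.eta,
      ContinuousLinearEquiv.apply_symm_apply]
  open_source := (((chartAt (EuclideanSpace ℝ (Fin M.dim)) q.1.1).open_source.preimage
    (continuous_fst.comp continuous_subtype_val)).inter ((fpDom hg q).open_source.preimage
    (continuous_snd.comp continuous_subtype_val)))
  open_target := fpTarget_open hf hg q
  continuousOn_toFun := (fpFwd_smooth hg q).continuousOn.comp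
    continuous_subtype_val.continuousOn (fun _ hp => hp)
  continuousOn_invFun := by
    rw [Topology.IsEmbedding.subtypeVal.continuousOn_iff]
    refine (fpBwd_smooth hf hg q).continuousOn.congr ?_
    intro x hx
    simp only [Function.comp, dif_pos hx]

lemma fpChart_symm_val {x : EuclideanSpace ℝ (Fin (M.dim + (N.dim - B.dim)))}
    (hx : x ∈ (fpChart hf hg q).target) : ((fpChart hf hg q).symm x).1 = fpBwd hg q x := by
  exact congrArg Subtype.val (dif_pos (show x ∈ fpTarget hg q from hx))

/-- The charts of the fibre product. -/
@[reducible] def fpCharted :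
    ChartedSpace (EuclideanSpace ℝ (Fin (M.dim + (N.dim - B.dim)))) (FP f g) where
  atlas := Set.range (fpChart hf hg)
  chartAt := fpChart hf hg
  mem_chart_source q := ⟨mem_chart_source _ _,
    (hg.isSubmersionOfComplement_complement q.1.2).mem_domChart_source⟩
  chart_mem_atlas := Set.mem_range_self

lemma fpManifold : @IsManifold ℝ _ _ _ _ _ _ (𝓡 (M.dim + (N.dim - B.dim))) ∞ (FP f g) _
    (fpCharted hf hg) := by
  let _ := fpCharted hf hg
  refine isManifold_of_contDiffOn _ _ _ ?_
  rintro _ _ ⟨q, rfl⟩ ⟨q', rfl⟩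
  rw [← contMDiffOn_iff_contDiffOn]
  have h : ContMDiffOn (𝓡 (M.dim + (N.dim - B.dim))) (𝓡 (M.dim + (N.dim - B.dim))) ∞
      (fun x => fpFwd hg q' (fpBwd hg q x))
      ((fpChart hf hg q).symm ≫ₕ fpChart hf hg q').source := by
    refine (fpFwd_smooth hg q').comp ((fpBwd_smooth hf hg q).mono ?_) ?_
    · intro x hx
      exact hx.1
    · intro x hx
      rw [Set.mem_preimage, ← fpChart_symm_val hf hg q hx.1]
      exact hx.2
  refine (h.congr ?_).mono ?_
  · intro x hx
    change fpFwd hg q' ((fpChart hf hg q).symm x).1 = _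
    rw [fpChart_symm_val hf hg q hx.1]
  · intro x hx
    simpa using hx

/-- The fibre product `M ×_B N = {(m, n) | f m = g n}` of a smooth map `f` and a submersion `g`,
as a submanifold of `M × N`. -/
def fiberProduct : Mfd.{u} where
  carrier := FP f g
  dim := M.dim + (N.dim - B.dim)
  charted := fpCharted hf hg
  smooth := fpManifold hf hg
  countable := TopologicalSpace.Subtype.secondCountableTopology {q : M × N | f q.1 = g q.2}

/-- The inclusion of the fibre product in the product is smooth. -/
lemma fiberProduct_val : ContMDiff (𝓡 (fiberProduct hf hg).dim) ((𝓡 M.dim).prod (𝓡 N.dim)) ∞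
    (fun q : fiberProduct hf hg => q.1) := by
  intro q
  let c := chartAt (EuclideanSpace ℝ (Fin (fiberProduct hf hg).dim)) q
  have hq : q ∈ c.source := mem_chart_source _ q
  have h1 : ContMDiffOn (𝓡 (fiberProduct hf hg).dim) (𝓡 (fiberProduct hf hg).dim) ∞ c c.source :=
    contMDiffOn_chart
  have h2 := (fpBwd_smooth hf hg q).comp h1 (fun p hp => c.map_source hp)
  refine (h2.congr ?_).contMDiffAt (c.open_source.mem_nhds hq)
  intro p hp
  exact (congrArg Subtype.val (c.left_inv hp)).symm.trans
    (fpChart_symm_val hf hg q (c.map_source hp))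

/-- A map to the fibre product is smooth if it is smooth as a map to the product. -/
lemma fiberProduct_lift {H : Type*} [TopologicalSpace H] {E : Type*}
    [NormedAddCommGroup E] [NormedSpace ℝ E] {I : ModelWithCorners ℝ E H}
    {T : Type*} [TopologicalSpace T] [ChartedSpace H T] {h : T → fiberProduct hf hg}
    (hh : ContMDiff I ((𝓡 M.dim).prod (𝓡 N.dim)) ∞ (fun t => (h t).1)) :
    ContMDiff I (𝓡 (fiberProduct hf hg).dim) ∞ h := by
  intro t
  have hc : Continuous h := continuous_induced_rng.2 hh.continuous
  let c := chartAt (EuclideanSpace ℝ (Fin (fiberProduct hf hg).dim)) (h t)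
  have hs : h ⁻¹' c.source ∈ nhds t :=
    (c.open_source.preimage hc).mem_nhds (show h t ∈ c.source from mem_chart_source _ (h t))
  have h1 : ContMDiffOn I 𝓘(ℝ, EuclideanSpace ℝ (Fin (fiberProduct hf hg).dim)) ∞
      (fun s => c (h s)) (h ⁻¹' c.source) :=
    (fpFwd_smooth hg (h t)).comp hh.contMDiffOn (fun s hs => hs)
  have h2 : ContMDiffOn (𝓡 (fiberProduct hf hg).dim) (𝓡 (fiberProduct hf hg).dim) ∞ c.symm
    c.target := contMDiffOn_chart_symm
  refine ((h2.comp h1 (fun s hs => c.map_source hs)).congr ?_).contMDiffAt hs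
  intro s hs
  exact (c.left_inv hs).symm

end FiberProduct
section Transport

variable (M : Mfd.{u}) {X : Type u} (e : X ≃ M)

/-- The topology transported along a bijection. -/
@[reducible] def transportTop : TopologicalSpace X := TopologicalSpace.induced e M.top

/-- The homeomorphism given by a bijection, for the transported topology. -/
def transportHomeo : @Homeomorph X M (transportTop M e) _ :=
  letI := transportTop M e
  e.toHomeomorphOfIsInducing ⟨rfl⟩

/-- The charts transported along a bijection. -/
@[reducible] def transportCharted :
    @ChartedSpace (EuclideanSpace ℝ (Fin M.dim)) _ X (transportTop M e) :=
  letI := transportTop M e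
  { atlas := {c | ∃ c' ∈ atlas (EuclideanSpace ℝ (Fin M.dim)) M.carrier,
      c = (transportHomeo M e).toOpenPartialHomeomorph ≫ₕ c'}
    chartAt := fun x => (transportHomeo M e).toOpenPartialHomeomorph ≫ₕ
      chartAt (EuclideanSpace ℝ (Fin M.dim)) (e x)
    mem_chart_source := fun _ =>
      ⟨trivial, mem_chart_source (EuclideanSpace ℝ (Fin M.dim)) _⟩
    chart_mem_atlas := fun _ => ⟨_, chart_mem_atlas _ _, rfl⟩ }

lemma transportManifold : @IsManifold ℝ _ _ _ _ _ _ (𝓡 M.dim) ∞ X (transportTop M e)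
    (transportCharted M e) := by
  let _ := transportTop M e
  let _ := transportCharted M e
  refine @IsManifold.mk _ _ _ _ _ _ _ _ _ _ _ _ ⟨?_⟩
  rintro _ _ ⟨c, hc, rfl⟩ ⟨c', hc', rfl⟩
  have e1 : ((transportHomeo M e).toOpenPartialHomeomorph ≫ₕ c).symm ≫ₕ
      ((transportHomeo M e).toOpenPartialHomeomorph ≫ₕ c') = c.symm ≫ₕ c' := by
    rw [OpenPartialHomeomorph.trans_symm_eq_symm_trans_symm, OpenPartialHomeomorph.trans_assoc,
      ← OpenPartialHomeomorph.trans_assoc (transportHomeo M e).toOpenPartialHomeomorph.symm,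
      ← Homeomorph.symm_toOpenPartialHomeomorph, ← Homeomorph.trans_toOpenPartialHomeomorph,
      Homeomorph.symm_trans_self, Homeomorph.refl_toOpenPartialHomeomorph,
      OpenPartialHomeomorph.refl_trans]
  rw [e1]
  exact HasGroupoid.compatible hc hc'

/-- The manifold structure on a set `X` obtained from a bijection of `X` with a manifold. -/
def transport : Mfd.{u} where
  carrier := X
  dim := M.dim
  top := transportTop M e
  charted := transportCharted M e
  smooth := transportManifold M e
  hausdorff := letI := transportTop M e; (transportHomeo M e).isEmbedding.t2Space
  countable := letI := transportTop M e; (transportHomeo M e).secondCountableTopology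

lemma transport_smooth : Smooth (M := M.transport e) (N := M) e := by
  let _ := transportTop M e
  let _ := transportCharted M e
  have _ := transportManifold M e
  change ContMDiff (𝓡 M.dim) (𝓡 M.dim) ∞ (e : X → M)
  intro x
  rw [contMDiffAt_iff_target]
  refine ⟨(transportHomeo M e).continuous.continuousAt, ?_⟩
  have := contMDiffAt_extChartAt (I := 𝓡 M.dim) (n := ∞) (x := x)
  exact this

lemma transport_symm_smooth : Smooth (M := M) (N := M.transport e) e.symm := by
  let _ := transportTop M e
  let _ := transportCharted M e
  have _ := transportManifold M e
  change ContMDiff (𝓡 M.dim) (𝓡 M.dim) ∞ (e.symm : M → X)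
  intro x
  rw [contMDiffAt_iff_target]
  refine ⟨(transportHomeo M e).symm.continuous.continuousAt, ?_⟩
  have h := contMDiffAt_extChartAt (I := 𝓡 M.dim) (n := ∞) (x := x)
  have h' : extChartAt (𝓡 M.dim) (e.symm x) ∘ e.symm = extChartAt (𝓡 M.dim) x := by
    funext y
    change extChartAt (𝓡 M.dim) (e (e.symm x)) (e (e.symm y)) = _
    rw [e.apply_symm_apply, e.apply_symm_apply]
  rw [h']
  exact h

end Transport

/-- The one-point manifold. -/
def point : Mfd.{u} where
  carrier := PUnit
  dim := 0
  charted := ChartedSpace.ofDiscreteTopology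
  smooth := IsManifold.of_discreteTopology _

lemma submersion_point (M : Mfd.{u}) :
    Submersion (M := M) (N := point) (fun _ => PUnit.unit) := by
  refine ⟨EuclideanSpace ℝ (Fin M.dim), inferInstance, inferInstance, fun x => ?_⟩
  refine Manifold.IsSubmersionAtOfComplement.mk_of_continuousAt continuousAt_const
    (ContinuousLinearEquiv.ofFinrankEq ?_) (chartAt _ x) (chartAt _ _)
    (mem_chart_source _ _) (mem_chart_source _ _)
    (IsManifold.chart_mem_maximalAtlas x) (IsManifold.chart_mem_maximalAtlas _) ?_
  · rw [Module.finrank_prod]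
    rw [finrank_euclideanSpace_fin, finrank_euclideanSpace_fin]
    exact (Nat.zero_add _).symm
  · intro y hy
    have : Subsingleton (EuclideanSpace ℝ (Fin point.dim)) := 
      inferInstanceAs (Subsingleton (EuclideanSpace ℝ (Fin 0)))
    exact Subsingleton.elim _ _

end Mfd

open Mfd

/-- A Lie groupoid `arr ⇉ obj` with target `tgt` and source `src`. The product `mul a b` is a total
function of which only the values with `src a = tgt b` have a meaning and are ever used. -/
structure LieGroupoid : Type (u + 1) where
  obj : Mfd.{u}
  arr : Mfd.{u}
  tgt : arr → obj
  src : arr → obj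
  unit : obj → arr
  inv : arr → arr
  mul : arr → arr → arr
  tgt_submersion : Submersion tgt
  src_submersion : Submersion src
  unit_smooth : Smooth unit
  inv_smooth : Smooth inv
  mul_smooth : Smooth (M := fiberProduct src_submersion.contMDiff tgt_submersion) (N := arr)
    (fun q => mul q.1.1 q.1.2)
  tgt_unit : ∀ x, tgt (unit x) = x
  src_unit : ∀ x, src (unit x) = x
  tgt_mul : ∀ a b, src a = tgt b → tgt (mul a b) = tgt a
  src_mul : ∀ a b, src a = tgt b → src (mul a b) = src b
  mul_assoc : ∀ a b c, src a = tgt b → src b = tgt c → mul (mul a b) c = mul a (mul b c)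
  unit_mul : ∀ a, mul (unit (tgt a)) a = a
  mul_unit : ∀ a, mul a (unit (src a)) = a
  tgt_inv : ∀ a, tgt (inv a) = src a
  src_inv : ∀ a, src (inv a) = tgt a
  inv_mul : ∀ a, mul (inv a) a = unit (src a)
  mul_inv : ∀ a, mul a (inv a) = unit (tgt a)

namespace LieGroupoid

variable (Γ : LieGroupoid.{u})

lemma tgt_smooth : Smooth Γ.tgt := Γ.tgt_submersion.contMDiff

lemma src_smooth : Smooth Γ.src := Γ.src_submersion.contMDiff

lemma mul_comp_smooth {T : Mfd.{u}} {a b : T → Γ.arr} (ha : Smooth a) (hb : Smooth b)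
    (h : ∀ t, Γ.src (a t) = Γ.tgt (b t)) : Smooth (fun t => Γ.mul (a t) (b t)) :=
  Γ.mul_smooth.comp (fiberProduct_lift _ _ (h := fun t => ⟨(a t, b t), h t⟩) (ha.prodMk hb))

/-- The Lie groupoid `G ⇉ pt` of a Lie group. -/
def ofLieGroup (G : Mfd.{u}) [Group G] [LieGroup (𝓡 G.dim) ∞ G] : LieGroupoid.{u} where
  obj := point
  arr := G
  tgt := fun _ => PUnit.unit
  src := fun _ => PUnit.unit
  unit := fun _ => 1
  inv := fun a => a⁻¹
  mul := fun a b => a * b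
  tgt_submersion := submersion_point G
  src_submersion := submersion_point G
  unit_smooth := contMDiff_const
  inv_smooth := contMDiff_inv (𝓡 G.dim) ∞
  mul_smooth := (contMDiff_mul (𝓡 G.dim) ∞).comp (fiberProduct_val _ _)
  tgt_unit := fun _ => rfl
  src_unit := fun _ => rfl
  tgt_mul := fun _ _ _ => rfl
  src_mul := fun _ _ _ => rfl
  mul_assoc := fun _ _ _ _ _ => _root_.mul_assoc _ _ _
  unit_mul := fun _ => one_mul _
  mul_unit := fun _ => mul_one _
  tgt_inv := fun _ => rfl
  src_inv := fun _ => rfl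
  inv_mul := fun _ => inv_mul_cancel _
  mul_inv := fun _ => mul_inv_cancel _

/-! ### The nerve -/

/-- An `n`-simplex of the nerve, as a functor `[n] → Γ`. It is the same as the string
`γ₁, …, γₙ` of composable arrows `γᵢ = edge (i - 1) i`, with `src γᵢ = tgt γᵢ₊₁`, together with its
vertices (for `n = 0`, just a point of `Γ.obj`). For `i ≤ j` we have
`edge i j = γᵢ₊₁ ⋯ γⱼ` (a unit if `i = j`), and `edge j i` is its inverse. -/
@[ext]
structure Simplex (n : ℕ) : Type u where
  vert : Fin (n + 1) → Γ.obj
  edge : Fin (n + 1) → Fin (n + 1) → Γ.arr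
  tgt_edge : ∀ i j, Γ.tgt (edge i j) = vert i
  src_edge : ∀ i j, Γ.src (edge i j) = vert j
  edge_self : ∀ i, edge i i = Γ.unit (vert i)
  edge_mul : ∀ i j k, Γ.mul (edge i j) (edge j k) = edge i k

variable {Γ}

namespace Simplex

/-- The action of a map of vertices on simplices. -/
def comp {n m : ℕ} (s : Γ.Simplex n) (θ : Fin (m + 1) → Fin (n + 1)) : Γ.Simplex m where
  vert i := s.vert (θ i)
  edge i j := s.edge (θ i) (θ j)
  tgt_edge _ _ := s.tgt_edge _ _
  src_edge _ _ := s.src_edge _ _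
  edge_self _ := s.edge_self _
  edge_mul _ _ _ := s.edge_mul _ _ _

/-- The constant simplex at a point. -/
def const (x : Γ.obj) : Γ.Simplex 0 where
  vert _ := x
  edge _ _ := Γ.unit x
  tgt_edge _ _ := Γ.tgt_unit x
  src_edge _ _ := Γ.src_unit x
  edge_self _ := rfl
  edge_mul _ _ _ := by
    have h := Γ.unit_mul (Γ.unit x)
    rwa [Γ.tgt_unit] at h

/-- The simplex with prescribed arrows from the `i`-th vertex to a fixed base point. -/
def ofStar {n : ℕ} (p : Fin (n + 1) → Γ.arr) (x : Γ.obj) (h : ∀ i, Γ.tgt (p i) = x) :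
    Γ.Simplex n where
  vert i := Γ.src (p i)
  edge i j := Γ.mul (Γ.inv (p i)) (p j)
  tgt_edge i j := by rw [Γ.tgt_mul _ _ (by rw [Γ.src_inv, h, h]), Γ.tgt_inv]
  src_edge i j := Γ.src_mul _ _ (by rw [Γ.src_inv, h, h])
  edge_self i := Γ.inv_mul _
  edge_mul i j k := by
    have hij : Γ.src (Γ.inv (p i)) = Γ.tgt (p j) := by rw [Γ.src_inv, h, h]
    have hjk : Γ.src (Γ.inv (p j)) = Γ.tgt (p k) := by rw [Γ.src_inv, h, h]
    rw [Γ.mul_assoc _ _ _ hij (by rw [Γ.tgt_mul _ _ hjk, Γ.tgt_inv]),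
      ← Γ.mul_assoc _ _ _ (Γ.tgt_inv _).symm hjk, Γ.mul_inv, h j, ← h k, Γ.unit_mul]

lemma edge_inv {n : ℕ} (s : Γ.Simplex n) (i j : Fin (n + 1)) :
    Γ.inv (s.edge i j) = s.edge j i := by
  have h1 : Γ.src (s.edge j i) = Γ.tgt (s.edge i j) := by rw [s.src_edge, s.tgt_edge]
  rw [← Γ.mul_unit (s.edge j i), h1, ← Γ.mul_inv, ← Γ.mul_assoc _ _ _ h1 (Γ.tgt_inv _).symm,
    s.edge_mul, s.edge_self, ← s.src_edge i j, ← Γ.tgt_inv, Γ.unit_mul]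

lemma ext_of_star {n : ℕ} {s t : Γ.Simplex n} (a : Fin (n + 1))
    (h : ∀ i, s.edge a i = t.edge a i) : s = t := by
  have hv : s.vert = t.vert := by
    funext i
    rw [← s.src_edge a i, h, t.src_edge]
  refine Simplex.ext hv ?_
  funext i j
  rw [← s.edge_mul i a j, ← t.edge_mul i a j, ← s.edge_inv a i, ← t.edge_inv a i, h, h]

/-- The arrows out of the last but one vertex of the simplex that extends `s` by the arrow `γ`. -/
def snocStar {n : ℕ} (s : Γ.Simplex n) (γ : Γ.arr) : Fin (n + 2) → Γ.arr :=
  Fin.lastCases γ (fun i => s.edge (Fin.last n) i)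

lemma snocStar_last {n : ℕ} (s : Γ.Simplex n) (γ : Γ.arr) :
    s.snocStar γ (Fin.last (n + 1)) = γ := Fin.lastCases_last

lemma snocStar_castSucc {n : ℕ} (s : Γ.Simplex n) (γ : Γ.arr) (i : Fin (n + 1)) :
    s.snocStar γ i.castSucc = s.edge (Fin.last n) i := Fin.lastCases_castSucc _

lemma tgt_snocStar {n : ℕ} (s : Γ.Simplex n) (γ : Γ.arr)
    (h : s.vert (Fin.last n) = Γ.tgt γ) (i : Fin (n + 2)) :
    Γ.tgt (s.snocStar γ i) = s.vert (Fin.last n) := by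
  refine Fin.lastCases ?_ (fun i => ?_) i
  · rw [snocStar_last, h]
  · rw [snocStar_castSucc, s.tgt_edge]

/-- The simplex `(γ₁, …, γₙ, γ)`, for a simplex `s = (γ₁, …, γₙ)`. -/
def snoc {n : ℕ} (s : Γ.Simplex n) (γ : Γ.arr) (h : s.vert (Fin.last n) = Γ.tgt γ) :
    Γ.Simplex (n + 1) :=
  ofStar (s.snocStar γ) (s.vert (Fin.last n)) (s.tgt_snocStar γ h)

lemma snoc_vert_last {n : ℕ} (s : Γ.Simplex n) (γ : Γ.arr) (h : s.vert (Fin.last n) = Γ.tgt γ) :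
    (s.snoc γ h).vert (Fin.last (n + 1)) = Γ.src γ :=
  congrArg Γ.src (s.snocStar_last γ)

lemma snoc_edge_star {n : ℕ} (s : Γ.Simplex n) (γ : Γ.arr) (h : s.vert (Fin.last n) = Γ.tgt γ)
    (i : Fin (n + 2)) : (s.snoc γ h).edge (Fin.last n).castSucc i = s.snocStar γ i := by
  change Γ.mul (Γ.inv (s.snocStar γ _)) (s.snocStar γ i) = _
  rw [snocStar_castSucc, s.edge_inv, s.edge_self, ← s.tgt_snocStar γ h i, Γ.unit_mul]

lemma snoc_init {n : ℕ} (s : Γ.Simplex n) (γ : Γ.arr) (h : s.vert (Fin.last n) = Γ.tgt γ) :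
    (s.snoc γ h).comp Fin.castSucc = s := by
  refine ext_of_star (Fin.last n) (fun i => ?_)
  exact (s.snoc_edge_star γ h _).trans (s.snocStar_castSucc γ i)

end Simplex

variable (Γ)

/-- The manifold of composable `n`-strings of arrows, as the iterated fibre product
`Γ.obj ×_{Γ.obj} Γ.arr ×_{Γ.obj} ⋯ ×_{Γ.obj} Γ.arr`, with its last vertex
(the source of the last arrow if `n > 0`). -/
def strings : ℕ → (M : Mfd.{u}) × {l : M → Γ.obj // Smooth l}
  | 0 => ⟨Γ.obj, id, contMDiff_id⟩
  | n + 1 => ⟨fiberProduct (strings n).2.2 Γ.tgt_submersion, fun q => Γ.src q.1.2,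
      Γ.src_smooth.comp (contMDiff_snd.comp (fiberProduct_val _ _))⟩

/-- The bijection between simplices and strings of composable arrows, which sends a simplex `s` to
`(s.vert 0, s.edge 0 1, …, s.edge (n - 1) n)`. -/
def simplexEquiv : (n : ℕ) → {e : Γ.Simplex n ≃ (Γ.strings n).1 //
    ∀ s, (Γ.strings n).2.1 (e s) = s.vert (Fin.last n)}
  | 0 => ⟨
    { toFun := fun s => s.vert 0
      invFun := Simplex.const
      left_inv := fun s => Simplex.ext_of_star 0 (fun i => by
        rw [Fin.eq_zero i, s.edge_self]
        rfl)
      right_inv := fun _ => rfl }, fun _ => rfl⟩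
  | n + 1 => ⟨
    { toFun := fun s => ⟨((simplexEquiv n).1 (s.comp Fin.castSucc),
          s.edge (Fin.last n).castSucc (Fin.last (n + 1))),
        ((simplexEquiv n).2 _).trans (s.tgt_edge _ _).symm⟩
      invFun := fun q => ((simplexEquiv n).1.symm q.1.1).snoc q.1.2
        (((simplexEquiv n).2 _).symm.trans
          ((congrArg _ ((simplexEquiv n).1.apply_symm_apply _)).trans q.2))
      left_inv := fun s => by
        refine Simplex.ext_of_star (Fin.last n).castSucc (fun i => ?_)
        rw [Simplex.snoc_edge_star]
        refine Fin.lastCases ?_ (fun i => ?_) i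
        · rw [Simplex.snocStar_last]
        · rw [Simplex.snocStar_castSucc, Equiv.symm_apply_apply]
          rfl
      right_inv := fun q => by
        refine Subtype.ext (Prod.ext ?_ ?_)
        · exact (congrArg _ (Simplex.snoc_init _ _ _)).trans ((simplexEquiv n).1.apply_symm_apply _)
        · exact (Simplex.snoc_edge_star _ _ (((simplexEquiv n).2 _).symm.trans
            ((congrArg _ ((simplexEquiv n).1.apply_symm_apply _)).trans q.2)) _).trans
            (Simplex.snocStar_last _ _) },
    fun s => s.src_edge _ _⟩

/-- The manifold of `n`-simplices of the nerve: the smooth structure is that of the submanifold of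
composable strings of arrows. -/
def simplices (n : ℕ) : Mfd.{u} := (Γ.strings n).1.transport (Γ.simplexEquiv n).1

lemma edge_smooth_aux (n : ℕ) : ∀ i j : Fin (n + 1), Smooth (M := (Γ.strings n).1) (N := Γ.arr)
    (fun q => ((Γ.simplexEquiv n).1.symm q).edge i j) := by
  induction n with
  | zero => exact fun _ _ => Γ.unit_smooth
  | succ n ih =>
    intro i j
    have hp : ∀ i : Fin (n + 2), Smooth (M := (Γ.strings (n + 1)).1) (N := Γ.arr)
        (fun q => ((Γ.simplexEquiv n).1.symm q.1.1).snocStar q.1.2 i) := by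
      intro i
      refine Fin.lastCases ?_ (fun i => ?_) i
      · simp only [Simplex.snocStar_last]
        exact contMDiff_snd.comp (fiberProduct_val _ _)
      · simp only [Simplex.snocStar_castSucc]
        exact (ih _ _).comp (contMDiff_fst.comp (fiberProduct_val _ _))
    refine Γ.mul_comp_smooth (Γ.inv_smooth.comp (hp i)) (hp j) (fun q => ?_)
    have hq := ((Γ.simplexEquiv n).2 _).symm.trans
      ((congrArg _ ((Γ.simplexEquiv n).1.apply_symm_apply _)).trans q.2)
    exact (Γ.src_inv _).trans ((Simplex.tgt_snocStar _ _ hq i).trans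
      (Simplex.tgt_snocStar _ _ hq j).symm)

lemma edge_smooth {n : ℕ} (i j : Fin (n + 1)) :
    Smooth (M := Γ.simplices n) (N := Γ.arr) (fun s => s.edge i j) := by
  have h := (Γ.edge_smooth_aux n i j).comp
    (transport_smooth (Γ.strings n).1 (Γ.simplexEquiv n).1)
  refine h.congr (fun s => ?_)
  exact congrArg (fun t : Γ.Simplex n => t.edge i j)
    ((Γ.simplexEquiv n).1.symm_apply_apply s).symm

lemma simplices_lift_aux {T : Mfd.{u}} (n : ℕ) (h : T → Γ.Simplex n)
    (hh : ∀ i j, Smooth (fun t => (h t).edge i j)) :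
    Smooth (M := T) (N := (Γ.strings n).1) (fun t => (Γ.simplexEquiv n).1 (h t)) := by
  induction n with
  | zero =>
    refine ContMDiff.congr (Γ.tgt_smooth.comp (hh 0 0)) (fun t => ?_)
    exact ((h t).tgt_edge 0 0).symm
  | succ n ih =>
    refine fiberProduct_lift _ _ ?_
    exact (ih (fun t => (h t).comp Fin.castSucc) (fun i j => hh _ _)).prodMk (hh _ _)

/-- A map to the manifold of simplices is smooth if all its edges are. -/
lemma simplices_lift {T : Mfd.{u}} {n : ℕ} (h : T → Γ.simplices n)
    (hh : ∀ i j, Smooth (fun t => Simplex.edge (h t) i j)) : Smooth h := by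
  have h1 := (transport_symm_smooth (Γ.strings n).1 (Γ.simplexEquiv n).1).comp
    (Γ.simplices_lift_aux n h hh)
  refine h1.congr (fun t => ?_)
  exact ((Γ.simplexEquiv n).1.symm_apply_apply (h t)).symm

/-- The nerve of a Lie groupoid, a simplicial manifold. The `i`-th face deletes the `i`-th vertex
(so it multiplies `γᵢ` and `γᵢ₊₁`, or omits the first or last arrow), the `i`-th degeneracy repeats the
`i`-th vertex (so it inserts a unit). -/
def nerve : SimplicialObject Mfd.{u} where
  obj n := Γ.simplices n.unop.len
  map θ := ⟨fun s => Simplex.comp s θ.unop.toOrderHom,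
    Γ.simplices_lift _ (fun _ _ => Γ.edge_smooth _ _)⟩
  map_id _ := rfl
  map_comp _ _ := rfl

end LieGroupoid

/-! ### Principal bundles -/

/-- `π : P → M` with the right action `act` of the Lie group `G` is a principal `G`-bundle:
the action is smooth and preserves the fibres, and `P` is locally isomorphic to `U × G`. -/
structure IsPrincipalBundle (G : Mfd.{u}) [Group G] {P M : Mfd.{u}} (π : P → M)
    (act : P → G → P) : Prop where
  proj_smooth : Smooth π
  act_smooth : ContMDiff ((𝓡 P.dim).prod (𝓡 G.dim)) (𝓡 P.dim) ∞ (fun q : P × G => act q.1 q.2)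
  act_one : ∀ p, act p 1 = p
  act_mul : ∀ p g h, act (act p g) h = act p (g * h)
  proj_act : ∀ p g, π (act p g) = π p
  locally_trivial : ∀ x : M, ∃ (U : Set M) (e : OpenPartialHomeomorph P (M × G)),
    IsOpen U ∧ x ∈ U ∧ e.source = π ⁻¹' U ∧ e.target = U ×ˢ Set.univ ∧
    ContMDiffOn (𝓡 P.dim) ((𝓡 M.dim).prod (𝓡 G.dim)) ∞ e e.source ∧
    ContMDiffOn ((𝓡 M.dim).prod (𝓡 G.dim)) (𝓡 P.dim) ∞ e.symm e.target ∧
    (∀ p ∈ e.source, (e p).1 = π p) ∧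
    (∀ p ∈ e.source, ∀ g, (e (act p g)).2 = (e p).2 * g)

/-- A left action of a Lie groupoid on a manifold `P` along a smooth map `π : P → Γ.obj`: `γ · p` is
defined if `src γ = π p` (the other values of `smul` have no meaning), and then
`π (γ · p) = tgt γ`. The pairs are listed as `(p, γ)` in the fibre product. -/
structure LeftAction (Γ : LieGroupoid.{u}) {P : Mfd.{u}} (π : P → Γ.obj) (hπ : Smooth π) where
  smul : Γ.arr → P → P
  smul_smooth : Smooth (M := fiberProduct hπ Γ.src_submersion) (N := P)
    (fun q => smul q.1.2 q.1.1)
  proj_smul : ∀ γ p, Γ.src γ = π p → π (smul γ p) = Γ.tgt γ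
  unit_smul : ∀ p, smul (Γ.unit (π p)) p = p
  mul_smul : ∀ γ₁ γ₂ p, Γ.src γ₂ = π p → Γ.src γ₁ = Γ.tgt γ₂ →
    smul γ₁ (smul γ₂ p) = smul (Γ.mul γ₁ γ₂) p

/-- A right action of a Lie groupoid on a manifold `P` along a smooth map `σ : P → H.obj`: `p · h` is
defined if `σ p = tgt h` (the other values of `smul` have no meaning), and then
`σ (p · h) = src h`. -/
structure RightAction (H : LieGroupoid.{u}) {P : Mfd.{u}} (σ : P → H.obj) (hσ : Smooth σ) where
  smul : P → H.arr → P
  smul_smooth : Smooth (M := fiberProduct hσ H.tgt_submersion) (N := P)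
    (fun q => smul q.1.1 q.1.2)
  proj_smul : ∀ p h, σ p = H.tgt h → σ (smul p h) = H.src h
  smul_unit : ∀ p, smul p (H.unit (σ p)) = p
  smul_mul : ∀ p h₁ h₂, σ p = H.tgt h₁ → H.src h₁ = H.tgt h₂ →
    smul (smul p h₁) h₂ = smul p (H.mul h₁ h₂)

/-! ### Principal bundles over a groupoid -/

/-- A principal `G`-bundle over a Lie groupoid: a principal `G`-bundle over the manifold of objects,
with a left action of the groupoid that commutes with the action of `G`. -/
structure GroupoidBundle (G : Mfd.{u}) [Group G] (Γ : LieGroupoid.{u}) : Type (u + 1) where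
  tot : Mfd.{u}
  proj : tot → Γ.obj
  act : tot → G → tot
  principal : IsPrincipalBundle G proj act
  left : LeftAction Γ proj principal.proj_smooth
  smul_act : ∀ γ p g, Γ.src γ = proj p → act (left.smul γ p) g = left.smul γ (act p g)

namespace GroupoidBundle

variable {G : Mfd.{u}} [Group G] {Γ : LieGroupoid.{u}}

/-- Morphisms: smooth maps over `Γ.obj` that are equivariant for `G` and for `Γ`. -/
@[ext]
structure Hom (P Q : GroupoidBundle G Γ) : Type u where
  map : P.tot → Q.tot
  smooth : Smooth map
  proj_map : ∀ p, Q.proj (map p) = P.proj p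
  map_act : ∀ p g, map (P.act p g) = Q.act (map p) g
  map_smul : ∀ γ p, Γ.src γ = P.proj p → map (P.left.smul γ p) = Q.left.smul γ (map p)

instance : Category (GroupoidBundle G Γ) where
  Hom := Hom
  id P := ⟨id, contMDiff_id, fun _ => rfl, fun _ _ => rfl, fun _ _ _ => rfl⟩
  comp f g := ⟨g.map ∘ f.map, g.smooth.comp f.smooth,
    fun p => (g.proj_map _).trans (f.proj_map p),
    fun p a => (congrArg g.map (f.map_act p a)).trans (g.map_act _ _),
    fun γ p h => (congrArg g.map (f.map_smul γ p h)).trans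
      (g.map_smul _ _ (h.trans (f.proj_map p).symm))⟩

end GroupoidBundle

/-! ### Principal bundles over a simplicial manifold -/

/-- A principal `G`-bundle over a simplicial manifold `X`: a simplicial manifold over `X`, in each
degree a principal `G`-bundle, such that the structure maps (the composites of the face and degeneracy
maps) are morphisms of principal bundles. -/
structure SimplicialBundle (G : Mfd.{u}) [Group G] (X : SimplicialObject Mfd.{u}) :
    Type (u + 1) where
  tot : SimplicialObject Mfd.{u}
  proj : tot ⟶ X
  act : ∀ n, tot.obj n → G → tot.obj n
  principal : ∀ n, IsPrincipalBundle G (proj.app n).1 (act n)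
  map_act : ∀ {n m} (θ : n ⟶ m) (p : tot.obj n) (g : G),
    (tot.map θ).1 (act n p g) = act m ((tot.map θ).1 p) g

namespace SimplicialBundle

variable {G : Mfd.{u}} [Group G] {X : SimplicialObject Mfd.{u}}

/-- Morphisms: simplicial smooth maps over `X` that are equivariant for `G`. -/
@[ext]
structure Hom (P Q : SimplicialBundle G X) : Type u where
  map : P.tot ⟶ Q.tot
  map_proj : map ≫ Q.proj = P.proj
  map_act : ∀ n (p : P.tot.obj n) (g : G),
    (map.app n).1 (P.act n p g) = Q.act n ((map.app n).1 p) g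

instance : Category (SimplicialBundle G X) where
  Hom := Hom
  id P := ⟨𝟙 _, Category.id_comp _, fun _ _ _ => rfl⟩
  comp f g := ⟨f.map ≫ g.map, by rw [Category.assoc, g.map_proj, f.map_proj],
    fun n p a => (congrArg (g.map.app n).1 (f.map_act n p a)).trans (g.map_act _ _ _)⟩
  id_comp f := Hom.ext (Category.id_comp _)
  comp_id f := Hom.ext (Category.comp_id _)
  assoc f g h := Hom.ext (Category.assoc _ _ _)

end SimplicialBundle

/-! ### Generalized homomorphisms -/

/-- A generalized homomorphism `Γ.obj ← Z → H.obj` of Lie groupoids: commuting actions of `Γ` and `H`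
on a manifold `Z`, such that `Z` is an `H`-principal bundle over `Γ.obj`. -/
structure GeneralizedHom (Γ H : LieGroupoid.{u}) : Type (u + 1) where
  tot : Mfd.{u}
  τ : tot → Γ.obj
  σ : tot → H.obj
  τ_submersion : Submersion τ
  τ_surjective : Function.Surjective τ
  σ_smooth : Smooth σ
  left : LeftAction Γ τ τ_submersion.contMDiff
  right : RightAction H σ σ_smooth
  σ_left : ∀ γ z, Γ.src γ = τ z → σ (left.smul γ z) = σ z
  τ_right : ∀ z h, σ z = H.tgt h → τ (right.smul z h) = τ z
  smul_comm : ∀ γ z h, Γ.src γ = τ z → σ z = H.tgt h →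
    right.smul (left.smul γ z) h = left.smul γ (right.smul z h)
  principal : ∀ z z', τ z = τ z' → ∃! h, σ z = H.tgt h ∧ right.smul z h = z'

namespace GeneralizedHom

variable {Γ H : LieGroupoid.{u}}

/-- Morphisms: smooth maps over `Γ.obj` and `H.obj` that are equivariant for `Γ` and for `H`. -/
@[ext]
structure Hom (Z W : GeneralizedHom Γ H) : Type u where
  map : Z.tot → W.tot
  smooth : Smooth map
  τ_map : ∀ z, W.τ (map z) = Z.τ z
  σ_map : ∀ z, W.σ (map z) = Z.σ z
  map_left : ∀ γ z, Γ.src γ = Z.τ z → map (Z.left.smul γ z) = W.left.smul γ (map z)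
  map_right : ∀ z h, Z.σ z = H.tgt h → map (Z.right.smul z h) = W.right.smul (map z) h

instance : Category (GeneralizedHom Γ H) where
  Hom := Hom
  id Z := ⟨id, contMDiff_id, fun _ => rfl, fun _ => rfl, fun _ _ _ => rfl, fun _ _ _ => rfl⟩
  comp f g := ⟨g.map ∘ f.map, g.smooth.comp f.smooth,
    fun z => (g.τ_map _).trans (f.τ_map z),
    fun z => (g.σ_map _).trans (f.σ_map z),
    fun γ z h => (congrArg g.map (f.map_left γ z h)).trans
      (g.map_left _ _ (h.trans (f.τ_map z).symm)),
    fun z a h => (congrArg g.map (f.map_right z a h)).trans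
      (g.map_right _ _ ((f.σ_map z).trans h))⟩

end GeneralizedHom

end LieGroupoids

end

/-! Both equivalences come from a fully faithful, essentially surjective functor out of the category
of bundles over the groupoid; the third is their composite.

To a bundle `P` over `Γ` corresponds the simplicial manifold of pairs (simplex `s`, point of `P`
over the initial vertex of `s`), where a structure map that changes the initial vertex transports
the point along the edge between the two vertices. Conversely, let `X` be a bundle over the nerve.
Each vertex map from degree `n` to degree `0` is a morphism of principal bundles, hence bijective on
fibres (`existsUnique_lift`), so `X` in degree `n` is the pullback of its degree `0` part along any
vertex (`existsUnique_vertex_eq`). Lifting the 1-simplex of an arrow and comparing the two vertices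
of the lift gives the action of `Γ` on the degree `0` part; 2-simplices give associativity. All
smoothness here rests on `contMDiff_of_proj_of_map`: a point of a principal bundle depends smoothly
on its projection and its image under a bundle morphism.

A generalized homomorphism to `G ⇉ pt` has the same data as a bundle over `Γ`, but local triviality
is replaced by a surjective submersion whose fibres are simply transitive `G`-sets, with no
smoothness assumed of the division map. The content is therefore `of_submersion`. A local section
`s` gives a smooth bijection `(x, g) ↦ s x · g` onto the part of the total space over an open set.
It is an immersion because orbit maps are: an injective smooth map is immersive where its rank is
maximal, and translations carry this to every point. The dimensions agree because a smooth map from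
a second countable manifold to one of larger dimension has an image without interior. The inverse
function theorem then makes the division map smooth. -/

noncomputable section

namespace LieGroupoids

open Mfd

/-! ### Smooth maps into fibre products -/

namespace Mfd

/-- A map to the fibre product is smooth at a point within a set if it is so as a map to the
product. -/
lemma fiberProduct_lift_within {M N B : Mfd.{u}} {f : M → B} {g : N → B} (hf : Smooth f)
    (hg : Submersion g) {H : Type*} [TopologicalSpace H] {E : Type*}
    [NormedAddCommGroup E] [NormedSpace ℝ E] {I : ModelWithCorners ℝ E H}
    {T : Type*} [TopologicalSpace T] [ChartedSpace H T] {h : T → fiberProduct hf hg}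
    {S : Set T} {t : T}
    (hh : ContMDiffWithinAt I ((𝓡 M.dim).prod (𝓡 N.dim)) ∞ (fun t => (h t).1) S t) :
    ContMDiffWithinAt I (𝓡 (fiberProduct hf hg).dim) ∞ h S t := by
  have hc : ContinuousWithinAt h S t :=
    Topology.IsInducing.subtypeVal.continuousWithinAt_iff.2 hh.continuousWithinAt
  let c := chartAt (EuclideanSpace ℝ (Fin (fiberProduct hf hg).dim)) (h t)
  have ht : h t ∈ c.source := mem_chart_source _ (h t)
  have hs : ∀ᶠ s in nhdsWithin t S, h s ∈ c.source := hc (c.open_source.mem_nhds ht)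
  have h1 : ContMDiffWithinAt I 𝓘(ℝ, EuclideanSpace ℝ (Fin (fiberProduct hf hg).dim)) ∞
      (fun s => c (h s)) S t := by
    refine ContMDiffAt.comp_contMDiffWithinAt (f := fun s => (h s).1) t
      ((fpFwd_smooth hg (h t)).contMDiffAt ?_) hh
    exact ((chartAt _ _).open_source.prod (fpDom hg (h t)).open_source).mem_nhds ht
  have h2 : ContMDiffAt (𝓡 (fiberProduct hf hg).dim) (𝓡 (fiberProduct hf hg).dim) ∞ c.symm
      (c (h t)) :=
    contMDiffOn_chart_symm.contMDiffAt (c.open_target.mem_nhds (c.map_source ht))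
  refine (h2.comp_contMDiffWithinAt t h1).congr_of_eventuallyEq ?_ (c.left_inv ht).symm
  filter_upwards [hs] with s hs
  exact (c.left_inv hs).symm

end Mfd

/-! ### Principal bundles through local sections and division maps -/

/-- Local data that trivialize a principal bundle over `U`: a section `s` and a map `d` with
`s (π p) · d p = p`. -/
structure IsLocalDivision {G : Mfd.{u}} {P M : Mfd.{u}} (π : P → M)
    (act : P → G → P) (U : Set M) (s : M → P) (d : P → G) : Prop where
  isOpen : IsOpen U
  section_smooth : ContMDiffOn (𝓡 M.dim) (𝓡 P.dim) ∞ s U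
  div_smooth : ContMDiffOn (𝓡 P.dim) (𝓡 G.dim) ∞ d (π ⁻¹' U)
  proj_section : ∀ x ∈ U, π (s x) = x
  act_div : ∀ p, π p ∈ U → act (s (π p)) (d p) = p

namespace IsPrincipalBundle

variable {G : Mfd.{u}} [Group G] {P M : Mfd.{u}} {π : P → M} {act : P → G → P}

/-- In a trivialization `e`, the section is `e⁻¹(x, 1)` and the division map is the group coordinate
of `e`. Equivariance of `d` is kept out of `IsLocalDivision` because for a free action it is
automatic. -/
lemma exists_localDivision (h : IsPrincipalBundle G π act) (x : M) :
    ∃ U s d, x ∈ U ∧ IsLocalDivision π act U s d ∧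
      ∀ p, π p ∈ U → ∀ g, d (act p g) = d p * g := by
  obtain ⟨U, e, hU, hx, hs, ht, he, hes, h1, h2⟩ := h.locally_trivial x
  have hm : ∀ y ∈ U, ∀ g : G, (y, g) ∈ e.target := fun y hy g => by
    rw [ht]
    exact ⟨hy, trivial⟩
  have hsrc : ∀ p, π p ∈ U → p ∈ e.source := fun p hp => by rwa [hs]
  have hsec : ∀ y ∈ U, π (e.symm (y, 1)) = y := fun y hy => by
    rw [← h1 _ (e.map_target (hm y hy 1)), e.right_inv (hm y hy 1)]
  refine ⟨U, fun y => e.symm (y, 1), fun p => (e p).2, hx, ⟨hU, ?_, ?_, hsec, ?_⟩,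
    fun p hp g => h2 p (hsrc p hp) g⟩
  · exact hes.comp (contMDiff_id.prodMk contMDiff_const).contMDiffOn (fun y hy => hm y hy 1)
  · rw [← hs]
    exact contMDiff_snd.comp_contMDiffOn he
  · intro p hp
    have hp' := e.map_target (hm _ hp 1)
    have hq : π (act (e.symm (π p, 1)) (e p).2) = π p := by rw [h.proj_act, hsec _ hp]
    refine e.injOn (hsrc _ (by rwa [hq])) (hsrc p hp) (Prod.ext ?_ ?_)
    · rw [h1 _ (hsrc _ (by rwa [hq])), h1 _ (hsrc p hp), hq]
    · rw [h2 _ hp', e.right_inv (hm _ hp 1), one_mul]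

lemma act_injective (h : IsPrincipalBundle G π act) (p : P) : Function.Injective (act p) := by
  intro g g' hg
  obtain ⟨U, s, d, hx, -, hd⟩ := h.exists_localDivision (π p)
  have := congrArg d hg
  rwa [hd p hx, hd p hx, mul_right_inj] at this

lemma exists_act_eq (h : IsPrincipalBundle G π act) {p q : P} (hpq : π p = π q) :
    ∃ g, act p g = q := by
  obtain ⟨U, s, d, hx, hl, -⟩ := h.exists_localDivision (π p)
  -- Both points are translates of the same point `s (π p)`, by `d p` and by `d q`.
  refine ⟨(d p)⁻¹ * d q, ?_⟩
  have hp := hl.act_div p hx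
  have hq := hl.act_div q (hpq ▸ hx)
  calc act p ((d p)⁻¹ * d q)
      = act (act (s (π p)) (d p)) ((d p)⁻¹ * d q) := by rw [hp]
    _ = q := by rw [h.act_mul, mul_inv_cancel_left, hpq, hq]

lemma proj_surjective (h : IsPrincipalBundle G π act) : Function.Surjective π := fun x =>
  let ⟨_, s, _, hx, hl, _⟩ := h.exists_localDivision x
  ⟨s x, hl.proj_section x hx⟩

/-- A smooth free action with local sections and smooth local divisions is a principal bundle. -/
lemma of_localDivision (proj_smooth : Smooth π)
    (act_smooth : ContMDiff ((𝓡 P.dim).prod (𝓡 G.dim)) (𝓡 P.dim) ∞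
      (fun q : P × G => act q.1 q.2))
    (act_one : ∀ p, act p 1 = p) (act_mul : ∀ p g h, act (act p g) h = act p (g * h))
    (proj_act : ∀ p g, π (act p g) = π p) (free : ∀ p, Function.Injective (act p))
    (hl : ∀ x, ∃ U s d, x ∈ U ∧ IsLocalDivision π act U s d) : IsPrincipalBundle G π act where
  proj_smooth := proj_smooth
  act_smooth := act_smooth
  act_one := act_one
  act_mul := act_mul
  proj_act := proj_act
  locally_trivial x := by
    obtain ⟨U, s, d, hx, hl⟩ := hl x
    have hfwd : ContMDiffOn (𝓡 P.dim) ((𝓡 M.dim).prod (𝓡 G.dim)) ∞ (fun p => (π p, d p))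
        (π ⁻¹' U) := proj_smooth.contMDiffOn.prodMk hl.div_smooth
    have hbwd : ContMDiffOn ((𝓡 M.dim).prod (𝓡 G.dim)) (𝓡 P.dim) ∞
        (fun q : M × G => act (s q.1) q.2) (U ×ˢ Set.univ) :=
      act_smooth.comp_contMDiffOn ((hl.section_smooth.comp contMDiff_fst.contMDiffOn
        (fun q hq => hq.1)).prodMk contMDiff_snd.contMDiffOn)
    let e : OpenPartialHomeomorph P (M × G) :=
      { toFun := fun p => (π p, d p)
        invFun := fun q => act (s q.1) q.2
        source := π ⁻¹' U
        target := U ×ˢ Set.univ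
        map_source' := fun p hp => ⟨hp, trivial⟩
        map_target' := fun q hq => by
          rw [Set.mem_preimage, proj_act, hl.proj_section _ hq.1]
          exact hq.1
        left_inv' := fun p hp => hl.act_div p hp
        right_inv' := fun q hq => by
          have h1 : π (act (s q.1) q.2) = q.1 := by rw [proj_act, hl.proj_section _ hq.1]
          refine Prod.ext h1 (free (s q.1) ?_)
          have h2 := hl.act_div (act (s q.1) q.2) (by rw [h1]; exact hq.1)
          rwa [h1] at h2
        open_source := hl.isOpen.preimage proj_smooth.continuous
        open_target := hl.isOpen.prod isOpen_univ
        continuousOn_toFun := hfwd.continuousOn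
        continuousOn_invFun := hbwd.continuousOn }
    refine ⟨U, e, hl.isOpen, hx, rfl, rfl, hfwd, hbwd, fun p _ => rfl, fun p hp g => ?_⟩
    -- Equivariance of `d`: both group elements take `s (π p)` to `act p g`, so they agree by
    -- freeness.
    refine free (s (π p)) ?_
    have h1 := hl.act_div p hp
    have h2 := hl.act_div (act p g) (by rw [proj_act]; exact hp)
    rw [proj_act] at h2
    change act _ (d (act p g)) = act _ (d p * g)
    rw [h2, ← act_mul, h1]

section Lift

variable {H : Type*} [TopologicalSpace H] {E : Type*}
    [NormedAddCommGroup E] [NormedSpace ℝ E] {I : ModelWithCorners ℝ E H}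
    {T : Type*} [TopologicalSpace T] [ChartedSpace H T]

/-- In a principal bundle, the group element that takes a point to another one of the same fibre
depends smoothly on the two points. -/
lemma contMDiffAt_of_act_eq [LieGroup (𝓡 G.dim) ∞ G] (h : IsPrincipalBundle G π act)
    {a b : T → P} {c : T → G}
    {t : T} (ha : ContMDiffAt I (𝓡 P.dim) ∞ a t) (hb : ContMDiffAt I (𝓡 P.dim) ∞ b t)
    (hc : ∀ᶠ t' in nhds t, act (a t') (c t') = b t') : ContMDiffAt I (𝓡 G.dim) ∞ c t := by
  obtain ⟨U, s, d, hx, hl, hd⟩ := h.exists_localDivision (π (a t))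
  have hab : π (b t) = π (a t) := by rw [← hc.self_of_nhds, h.proj_act]
  have hU : ∀ p, π p ∈ U → ContMDiffAt (𝓡 P.dim) (𝓡 G.dim) ∞ d p := fun p hp =>
    hl.div_smooth.contMDiffAt ((hl.isOpen.preimage h.proj_smooth.continuous).mem_nhds hp)
  -- Near `t`, equivariance of `d` forces `c = d(a)⁻¹ d(b)`.
  have h1 := (((hU _ hx).comp t ha).inv).mul ((hU _ (hab ▸ hx)).comp t hb)
  refine h1.congr_of_eventuallyEq ?_
  filter_upwards [hc, ha.continuousAt.preimage_mem_nhds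
    ((hl.isOpen.preimage h.proj_smooth.continuous).mem_nhds hx)] with t' h2 h3
  change c t' = (d (a t'))⁻¹ * d (b t')
  rw [← h2, hd _ h3, inv_mul_cancel_left]

/-- A point of a principal bundle `P` depends smoothly on its projection and its image under a
morphism from `P` to a principal bundle. -/
lemma contMDiff_of_proj_of_map [LieGroup (𝓡 G.dim) ∞ G] (h : IsPrincipalBundle G π act)
    {P' M' : Mfd.{u}} {π' : P' → M'} {act' : P' → G → P'} (h' : IsPrincipalBundle G π' act')
    {F : P → P'} (hF : Smooth F) (hact : ∀ p g, F (act p g) = act' (F p) g)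
    {c : T → P} (hc : ContMDiff I (𝓡 M.dim) ∞ (fun t => π (c t)))
    (hFc : ContMDiff I (𝓡 P'.dim) ∞ (fun t => F (c t))) : ContMDiff I (𝓡 P.dim) ∞ c := by
  intro t
  obtain ⟨U, s, d, hx, hl, hd⟩ := h.exists_localDivision (π (c t))
  have hU : ∀ᶠ t' in nhds t, π (c t') ∈ U :=
    hc.continuous.continuousAt.preimage_mem_nhds (hl.isOpen.mem_nhds hx)
  have hs : ContMDiffAt I (𝓡 P.dim) ∞ (fun t' => s (π (c t'))) t :=
    (hl.section_smooth.contMDiffAt (hl.isOpen.mem_nhds hx)).comp t hc.contMDiffAt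
  have h1 : ∀ᶠ t' in nhds t, act (s (π (c t'))) (d (c t')) = c t' := by
    filter_upwards [hU] with t' ht'
    exact hl.act_div _ ht'
  -- Applying `F` to `s (π c) · d c = c` exhibits `d ∘ c` as the quotient of two smooth maps into
  -- `P'`, where division is smooth. No smoothness of `c` itself is used.
  have hdc : ContMDiffAt I (𝓡 G.dim) ∞ (fun t' => d (c t')) t := by
    refine h'.contMDiffAt_of_act_eq (hF.contMDiffAt.comp t hs) hFc.contMDiffAt ?_
    filter_upwards [h1] with t' ht'
    rw [Function.comp_apply, ← hact, ht']
  refine (h.act_smooth.contMDiffAt.comp t (hs.prodMk hdc)).congr_of_eventuallyEq ?_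
  filter_upwards [h1] with t' ht'
  exact ht'.symm

end Lift

/-- Over a given point of the base, a morphism of principal bundles is bijective on the fibre. -/
lemma existsUnique_lift (h : IsPrincipalBundle G π act)
    {P' M' : Mfd.{u}} {π' : P' → M'} {act' : P' → G → P'} (h' : IsPrincipalBundle G π' act')
    {F : P → P'} {f : M → M'} (hf : ∀ p, π' (F p) = f (π p))
    (hact : ∀ p g, F (act p g) = act' (F p) g) {x : M} {y : P'} (hy : π' y = f x) :
    ∃! p, π p = x ∧ F p = y := by
  obtain ⟨p, hp⟩ := h.proj_surjective x
  obtain ⟨g, hg⟩ := h'.exists_act_eq (p := F p) (q := y) (by rw [hf, hp, hy])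
  -- Existence uses transitivity on the fibres of `P'`; uniqueness uses transitivity on those of `P`
  -- and freeness on `P'`.
  refine ⟨act p g, ⟨by rw [h.proj_act, hp], by rw [hact, hg]⟩, ?_⟩
  rintro q ⟨hq, rfl⟩
  obtain ⟨k, rfl⟩ := h.exists_act_eq (hp.trans hq.symm)
  rw [hact] at hg
  rw [h'.act_injective _ hg]

end IsPrincipalBundle

/-! ### Projections of principal bundles as submersions, and pullbacks -/

namespace IsPrincipalBundle

variable {G : Mfd.{u}} [Group G] {P M : Mfd.{u}} {π : P → M} {act : P → G → P}

/-- The projection of a principal bundle is a submersion. -/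
lemma proj_submersion (h : IsPrincipalBundle G π act) : Submersion π := by
  refine ⟨EuclideanSpace ℝ (Fin G.dim), inferInstance, inferInstance, fun p => ?_⟩
  obtain ⟨U, e, hU, hx, hs, ht, he, hes, h1, -⟩ := h.locally_trivial (π p)
  have hp : p ∈ e.source := by rwa [hs]
  -- The definition does not relate the dimensions; the derivative of the trivialization at `p`
  -- does. After that any linear identification `L` of the model spaces will do.
  have hdim : P.dim = M.dim + G.dim := by
    have hl : IsLocalDiffeomorphAt (𝓡 P.dim) ((𝓡 M.dim).prod (𝓡 G.dim)) ∞ e p :=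
      ⟨⟨e.toPartialEquiv, e.open_source, e.open_target, he, hes⟩, hp, fun _ _ => rfl⟩
    have L : EuclideanSpace ℝ (Fin P.dim) ≃L[ℝ]
        (EuclideanSpace ℝ (Fin M.dim) × EuclideanSpace ℝ (Fin G.dim)) :=
      hl.mfderivToContinuousLinearEquiv (by simp)
    have := L.toLinearEquiv.finrank_eq
    rwa [Module.finrank_prod, finrank_euclideanSpace_fin, finrank_euclideanSpace_fin,
      finrank_euclideanSpace_fin] at this
  let L : EuclideanSpace ℝ (Fin P.dim) ≃L[ℝ]
      (EuclideanSpace ℝ (Fin M.dim) × EuclideanSpace ℝ (Fin G.dim)) :=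
    ContinuousLinearEquiv.ofFinrankEq (by simp [hdim])
  let cM := chartAt (EuclideanSpace ℝ (Fin M.dim)) (π p)
  let cG := chartAt (EuclideanSpace ℝ (Fin G.dim)) (e p).2
  -- The trivialization followed by a product chart: in `φ` and `cM` the projection reads as the
  -- first component of `L`.
  let φ : OpenPartialHomeomorph P (EuclideanSpace ℝ (Fin P.dim)) :=
    (e.trans (cM.prod cG)).trans L.symm.toHomeomorph.toOpenPartialHomeomorph
  have hφs : ∀ q ∈ φ.source, q ∈ e.source ∧ (e q).1 ∈ cM.source ∧ (e q).2 ∈ cG.source := by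
    intro q hq
    simpa [φ] using hq
  have hφt : ∀ x ∈ φ.target, (L x).1 ∈ cM.target ∧ (L x).2 ∈ cG.target ∧
      (cM.symm (L x).1, cG.symm (L x).2) ∈ e.target := by
    intro x hx
    simpa [φ, and_assoc] using hx
  refine Manifold.IsSubmersionAtOfComplement.mk_of_continuousAt h.proj_smooth.continuous.continuousAt
    L φ cM ?_ (mem_chart_source _ _) ?_ (IsManifold.chart_mem_maximalAtlas _) ?_
  · have : (e p).1 ∈ cM.source := by
      rw [h1 p hp]
      exact mem_chart_source _ _
    have h2 : (e p).2 ∈ cG.source := mem_chart_source _ _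
    simpa [φ, hp, this] using h2
  · refine OpenPartialHomeomorph.mem_maximalAtlas_of_contMDiffOn φ ?_ ?_
    · have he' := he.mono (fun q hq => (hφs q hq).1)
      have a1 : ContMDiffOn (𝓡 P.dim) 𝓘(ℝ, EuclideanSpace ℝ (Fin M.dim)) ∞
          (fun q => cM (e q).1) φ.source :=
        (contMDiffOn_chart (I := 𝓡 M.dim)).comp (contMDiff_fst.comp_contMDiffOn he')
          (fun q hq => (hφs q hq).2.1)
      have a2 : ContMDiffOn (𝓡 P.dim) 𝓘(ℝ, EuclideanSpace ℝ (Fin G.dim)) ∞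
          (fun q => cG (e q).2) φ.source :=
        (contMDiffOn_chart (I := 𝓡 G.dim)).comp (contMDiff_snd.comp_contMDiffOn he')
          (fun q hq => (hφs q hq).2.2)
      exact L.symm.toContinuousLinearMap.contMDiff.comp_contMDiffOn (a1.prodMk_space a2)
    · have a1 : ContMDiffOn (𝓡 P.dim) (𝓡 M.dim) ∞ (fun x => cM.symm (L x).1) φ.target :=
        (contMDiffOn_chart_symm (I := 𝓡 M.dim)).comp
          ((ContinuousLinearMap.fst ℝ _ _).comp L.toContinuousLinearMap).contMDiff.contMDiffOn
          (fun q hq => (hφt q hq).1)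
      have a2 : ContMDiffOn (𝓡 P.dim) (𝓡 G.dim) ∞ (fun x => cG.symm (L x).2) φ.target :=
        (contMDiffOn_chart_symm (I := 𝓡 G.dim)).comp
          ((ContinuousLinearMap.snd ℝ _ _).comp L.toContinuousLinearMap).contMDiff.contMDiffOn
          (fun q hq => (hφt q hq).2.1)
      exact hes.comp (a1.prodMk a2) (fun q hq => (hφt q hq).2.2)
  · intro x hx
    have hx' : x ∈ φ.target := by simpa using hx
    obtain ⟨b1, -, b3⟩ := hφt x hx'
    have : cM (π (e.symm (cM.symm (L x).1, cG.symm (L x).2))) = (L x).1 := by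
      rw [← h1 _ (e.map_target b3), e.right_inv b3, cM.right_inv b1]
    simpa [φ] using this

end IsPrincipalBundle

namespace IsPrincipalBundle

variable {G : Mfd.{u}} [Group G] {P M : Mfd.{u}} {π : P → M} {act : P → G → P}

/-- The action on the pullback of a principal bundle. -/
def pullbackAct (h : IsPrincipalBundle G π act) {N : Mfd.{u}} {f : N → M} (hf : Smooth f)
    (q : fiberProduct hf h.proj_submersion) (g : G) : fiberProduct hf h.proj_submersion :=
  ⟨(q.1.1, act q.1.2 g), q.2.trans (h.proj_act _ _).symm⟩

/-- The pullback of a principal bundle is a principal bundle. -/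
lemma pullback (h : IsPrincipalBundle G π act) {N : Mfd.{u}} {f : N → M} (hf : Smooth f) :
    IsPrincipalBundle G (P := fiberProduct hf h.proj_submersion) (fun q => q.1.1)
      (h.pullbackAct hf) := by
  have hfst : Smooth (M := fiberProduct hf h.proj_submersion) (N := N) (fun q => q.1.1) :=
    contMDiff_fst.comp (fiberProduct_val _ _)
  have hsnd : Smooth (M := fiberProduct hf h.proj_submersion) (N := P) (fun q => q.1.2) :=
    contMDiff_snd.comp (fiberProduct_val _ _)
  refine of_localDivision hfst ?_ ?_ ?_ (fun _ _ => rfl) ?_ ?_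
  · refine fiberProduct_lift _ _ ?_
    exact (hfst.comp contMDiff_fst).prodMk
      (h.act_smooth.comp ((hsnd.comp contMDiff_fst).prodMk contMDiff_snd))
  · exact fun q => Subtype.ext (Prod.ext rfl (h.act_one _))
  · exact fun q g g' => Subtype.ext (Prod.ext rfl (h.act_mul _ _ _))
  · intro q g g' hg
    exact h.act_injective _ (congrArg (fun q => q.1.2) hg)
  · intro x
    obtain ⟨U, s, d, hx, hl, -⟩ := h.exists_localDivision (f x)
    classical
    -- A section must be a total function. Off `f ⁻¹' U` it takes a constant junk value, so
    -- smoothness is only available within that set.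
    let s' : N → fiberProduct hf h.proj_submersion := fun y =>
      if hy : f y ∈ U then ⟨(y, s (f y)), (hl.proj_section _ hy).symm⟩
      else ⟨(x, s (f x)), (hl.proj_section _ hx).symm⟩
    have hs' : ∀ y ∈ f ⁻¹' U, (s' y).1 = (y, s (f y)) := fun y hy =>
      congrArg Subtype.val (dif_pos hy)
    refine ⟨f ⁻¹' U, s', fun q => d q.1.2, hx, hl.isOpen.preimage hf.continuous, ?_, ?_, ?_, ?_⟩
    · intro y hy
      refine fiberProduct_lift_within _ _ ?_
      refine ContMDiffWithinAt.congr (f := fun y => (y, s (f y))) ?_ hs' (hs' y hy)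
      exact contMDiffWithinAt_id.prodMk
        (hl.section_smooth.comp hf.contMDiffOn (fun y hy => hy) y hy)
    · refine hl.div_smooth.comp hsnd.contMDiffOn (fun q hq => ?_)
      exact (congrArg (· ∈ U) (show f q.1.1 = π q.1.2 from q.2)).mp hq
    · intro y hy
      rw [hs' y hy]
    · rintro ⟨⟨y, p⟩, hq⟩ hy
      refine Subtype.ext ((Prod.ext ?_ ?_ : _ = ((y, p) : N × P)))
      · change (s' y).1.1 = y
        rw [hs' y hy]
      · change act (s' y).1.2 (d p) = p
        change f y = π p at hq
        rw [hs' y hy, hq]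
        exact hl.act_div p (hq ▸ hy)

end IsPrincipalBundle

/-! ### From bundles over the groupoid to bundles over the nerve -/

namespace LeftAction

variable {Γ : LieGroupoid.{u}} {P : Mfd.{u}} {π : P → Γ.obj} {hπ : Smooth π}
  (L : LeftAction Γ π hπ)

lemma smul_comp_smooth {T : Mfd.{u}} {γ : T → Γ.arr} {p : T → P}
    (hγ : Smooth γ) (hp : Smooth p) (h : ∀ t, Γ.src (γ t) = π (p t)) :
    Smooth (fun t => L.smul (γ t) (p t)) :=
  L.smul_smooth.comp
    (fiberProduct_lift _ _ (h := fun t => ⟨(p t, γ t), (h t).symm⟩) (hp.prodMk hγ))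

variable {n : ℕ} (s : Γ.Simplex n) {p : P}

lemma proj_edge_smul (i : Fin (n + 1)) {j : Fin (n + 1)} (h : s.vert j = π p) :
    π (L.smul (s.edge i j) p) = s.vert i := by
  rw [L.proj_smul _ _ ((s.src_edge i j).trans h), s.tgt_edge]

lemma edge_self_smul {i : Fin (n + 1)} (h : s.vert i = π p) : L.smul (s.edge i i) p = p := by
  rw [s.edge_self, h, L.unit_smul]

/-- Transport from the fibre over vertex `k` to that over vertex `i` does not depend on an
intermediate vertex. This cocycle rule is what makes `simplicialTot` functorial. -/
lemma edge_smul_smul (i j : Fin (n + 1)) {k : Fin (n + 1)} (h : s.vert k = π p) :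
    L.smul (s.edge i j) (L.smul (s.edge j k) p) = L.smul (s.edge i k) p := by
  rw [L.mul_smul _ _ _ ((s.src_edge j k).trans h) ((s.src_edge i j).trans (s.tgt_edge j k).symm),
    s.edge_mul]

end LeftAction

lemma LieGroupoid.vert_smooth (Γ : LieGroupoid.{u}) {n : ℕ} (i : Fin (n + 1)) :
    Smooth (M := Γ.simplices n) (N := Γ.obj) (fun s => Simplex.vert s i) :=
  (Γ.src_smooth.comp (Γ.edge_smooth i i)).congr (fun s => (Simplex.src_edge s i i).symm)

namespace GroupoidBundle

variable {G : Mfd.{u}} [Group G] {Γ : LieGroupoid.{u}}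

/-- The simplicial manifold whose `n`-simplices are the pairs of an `n`-simplex of the nerve and a
point of the bundle over its initial vertex. -/
def simplicialTot (P : GroupoidBundle G Γ) : SimplicialObject Mfd.{u} where
  obj n := fiberProduct (Γ.vert_smooth (n := n.unop.len) 0) P.principal.proj_submersion
  -- The initial vertex of the new simplex is vertex `θ 0` of the old one, so the point moves from
  -- the fibre over vertex `0` along `edge (θ 0) 0`, whose source is vertex `0`. If `θ 0 = 0` this
  -- is a unit.
  map {n _} θ := ⟨fun q => ⟨(Γ.nerve.map θ |>.1 q.1.1,
      P.left.smul (LieGroupoid.Simplex.edge q.1.1 (θ.unop.toOrderHom 0) 0) q.1.2),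
      (P.left.proj_edge_smul q.1.1 _ q.2).symm⟩, by
    have hfst := contMDiff_fst.comp (fiberProduct_val (Γ.vert_smooth (n := n.unop.len) 0)
      P.principal.proj_submersion)
    have hsnd := contMDiff_snd.comp (fiberProduct_val (Γ.vert_smooth (n := n.unop.len) 0)
      P.principal.proj_submersion)
    refine fiberProduct_lift _ _ (((Γ.nerve.map θ).2.comp hfst).prodMk ?_)
    exact P.left.smul_comp_smooth ((Γ.edge_smooth _ _).comp hfst) hsnd
      (fun q => (LieGroupoid.Simplex.src_edge _ _ _).trans q.2)⟩
  map_id n := Subtype.ext (funext fun q => Subtype.ext (Prod.ext rfl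
    (P.left.edge_self_smul q.1.1 q.2)))
  map_comp θ θ' := Subtype.ext (funext fun q => Subtype.ext (Prod.ext rfl
    (P.left.edge_smul_smul q.1.1 (θ.unop.toOrderHom (θ'.unop.toOrderHom 0))
      (θ.unop.toOrderHom 0) q.2).symm))

/-- The principal bundle over the nerve given by a principal bundle over a groupoid. -/
def toSimplicial (P : GroupoidBundle G Γ) : SimplicialBundle G Γ.nerve where
  tot := P.simplicialTot
  proj := { app := fun _ => ⟨fun q => q.1.1, contMDiff_fst.comp (fiberProduct_val _ _)⟩ }
  act n := P.principal.pullbackAct (Γ.vert_smooth (n := n.unop.len) 0)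
  principal n := P.principal.pullback _
  map_act _ q g := Subtype.ext (Prod.ext rfl
    (P.smul_act _ _ g ((LieGroupoid.Simplex.src_edge _ _ _).trans q.2)).symm)

/-- A morphism of principal bundles over a groupoid gives one of principal bundles over the
nerve. -/
def toSimplicialMap {P Q : GroupoidBundle G Γ} (f : P ⟶ Q) : P.toSimplicial ⟶ Q.toSimplicial where
  map :=
    { app := fun _ => ⟨fun q => ⟨(q.1.1, Hom.map f q.1.2), q.2.trans (Hom.proj_map f _).symm⟩,
        fiberProduct_lift _ _ ((contMDiff_fst.comp (fiberProduct_val _ _)).prodMk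
          ((Hom.smooth f).comp (contMDiff_snd.comp (fiberProduct_val _ _))))⟩
      naturality := fun _ _ _ => Subtype.ext (funext fun q => Subtype.ext (Prod.ext rfl
        (Hom.map_smul f _ _ ((LieGroupoid.Simplex.src_edge _ _ _).trans q.2)))) }
  map_proj := rfl
  map_act _ _ _ := Subtype.ext (Prod.ext rfl (Hom.map_act f _ _))

variable (G Γ) in
/-- The functor from principal bundles over a groupoid to principal bundles over its nerve. -/
def simplicialFunctor : GroupoidBundle G Γ ⥤ SimplicialBundle G Γ.nerve where
  obj := toSimplicial
  map := toSimplicialMap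

end GroupoidBundle

/-! ### Low-dimensional simplices of the nerve, and full faithfulness -/

open scoped Simplicial

namespace LieGroupoid

variable {Γ : LieGroupoid.{u}}

/-- The `1`-simplex of the nerve given by an arrow. -/
def Simplex.arrow (γ : Γ.arr) : Γ.Simplex 1 := (const (Γ.tgt γ)).snoc γ rfl

lemma Simplex.arrow_edge (γ : Γ.arr) : (arrow γ).edge 0 1 = γ :=
  (snoc_edge_star (const (Γ.tgt γ)) γ rfl 1).trans (snocStar_last _ _)

lemma Simplex.arrow_vert_zero (γ : Γ.arr) : (arrow γ).vert 0 = Γ.tgt γ := by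
  rw [← (arrow γ).tgt_edge 0 1, arrow_edge]

lemma Simplex.arrow_vert_one (γ : Γ.arr) : (arrow γ).vert 1 = Γ.src γ := by
  rw [← (arrow γ).src_edge 0 1, arrow_edge]

lemma Simplex.ext_zero {s t : Γ.Simplex 0} (h : s.vert 0 = t.vert 0) : s = t :=
  ext_of_star 0 (fun i => by rw [Fin.eq_zero i, s.edge_self, t.edge_self, h])

lemma Simplex.ext_one {s t : Γ.Simplex 1} (h : s.edge 0 1 = t.edge 0 1) : s = t := by
  refine ext_of_star 0 (fun i => ?_)
  match i with
  | 0 => rw [s.edge_self, t.edge_self, ← s.tgt_edge 0 1, h, t.tgt_edge]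
  | 1 => exact h

lemma const_smooth : Smooth (M := Γ.obj) (N := Γ.simplices 0) Simplex.const :=
  Γ.simplices_lift _ (fun _ _ => Γ.unit_smooth)

lemma arrow_smooth : Smooth (M := Γ.arr) (N := Γ.simplices 1) Simplex.arrow := by
  refine Γ.simplices_lift _ (fun i j => ?_)
  have h01 : Smooth (fun γ : Γ.arr => (Simplex.arrow γ).edge 0 1) := by
    simp only [Simplex.arrow_edge]
    exact contMDiff_id
  have h0 : ∀ i, Smooth (fun γ : Γ.arr => (Simplex.arrow γ).edge 0 i) := by
    intro i
    match i with
    | 0 =>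
      simp only [Simplex.edge_self, Simplex.arrow_vert_zero]
      exact Γ.unit_smooth.comp Γ.tgt_smooth
    | 1 => exact h01
  have h1 : ∀ i, Smooth (fun γ : Γ.arr => (Simplex.arrow γ).edge i 0) := by
    intro i
    simp only [← fun γ => (Simplex.arrow γ).edge_inv 0 i]
    exact Γ.inv_smooth.comp (h0 i)
  -- Every edge is a product `edge i 0 · edge 0 j`, so the edges at vertex `0` suffice.
  refine (Γ.mul_comp_smooth (h1 i) (h0 j) (fun γ => ?_)).congr (fun γ => ?_)
  · rw [Simplex.src_edge, Simplex.tgt_edge]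
  · rw [Simplex.edge_mul]

end LieGroupoid

open LieGroupoid

/-- The inclusion of the `i`-th vertex, in the opposite of the simplex category. -/
def vertexMap (n : SimplexCategoryᵒᵖ) (i : Fin (n.unop.len + 1)) : n ⟶ Opposite.op ⦋0⦌ :=
  (SimplexCategory.const ⦋0⦌ n.unop i).op

namespace GroupoidBundle

variable {G : Mfd.{u}} [Group G] {Γ : LieGroupoid.{u}}

/-- The identification of a bundle with the degree zero part of its simplicial bundle. -/
def toVertices (P : GroupoidBundle G Γ) (p : P.tot) : P.simplicialTot.obj (Opposite.op ⦋0⦌) :=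
  ⟨(Simplex.const (P.proj p), p), rfl⟩

/-- The underlying point of a simplex of the simplicial bundle. -/
def point (P : GroupoidBundle G Γ) {n : SimplexCategoryᵒᵖ} (q : P.simplicialTot.obj n) : P.tot :=
  q.1.2

/-- The simplex of the nerve under a simplex of the simplicial bundle. -/
def simplex (P : GroupoidBundle G Γ) {n : SimplexCategoryᵒᵖ} (q : P.simplicialTot.obj n) :
    Γ.Simplex n.unop.len := q.1.1

variable (P Q : GroupoidBundle G Γ)

lemma simplicialTot_ext {n : SimplexCategoryᵒᵖ} {q r : P.simplicialTot.obj n}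
    (h₁ : P.simplex q = P.simplex r) (h₂ : P.point q = P.point r) : q = r :=
  Subtype.ext (Prod.ext h₁ h₂)

lemma vert_simplex {n : SimplexCategoryᵒᵖ} (q : P.simplicialTot.obj n) :
    (P.simplex q).vert 0 = P.proj (P.point q) := q.2

lemma toVertices_smooth : Smooth P.toVertices :=
  fiberProduct_lift _ _ ((const_smooth.comp P.principal.proj_smooth).prodMk contMDiff_id)

lemma point_smooth (n : SimplexCategoryᵒᵖ) :
    Smooth (M := P.simplicialTot.obj n) (N := P.tot) P.point :=
  contMDiff_snd.comp (fiberProduct_val _ _)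

lemma toVertices_point (q : P.simplicialTot.obj (Opposite.op ⦋0⦌)) :
    P.toVertices (P.point q) = q :=
  P.simplicialTot_ext (Simplex.ext_zero (P.vert_simplex q).symm) rfl

/-- The vertices of a simplex over `s` are the transports of its point to the vertices of `s`, so
naturality at vertex inclusions carries information about the action of `Γ`. -/
lemma vertexMap_apply {n : SimplexCategoryᵒᵖ} (i : Fin (n.unop.len + 1))
    (q : P.simplicialTot.obj n) : (P.simplicialTot.map (vertexMap n i)).1 q =
      P.toVertices (P.left.smul ((P.simplex q).edge i 0) (P.point q)) :=
  (P.toVertices_point _).symm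

section Full

variable {P Q} (h : P.toSimplicial ⟶ Q.toSimplicial)

/-- The components of a morphism between simplicial bundles. -/
def component {n : SimplexCategoryᵒᵖ} (q : P.simplicialTot.obj n) : Q.simplicialTot.obj n :=
  (h.map.app n).1 q

/-- The map between groupoid bundles given by a map between their simplicial bundles. -/
def vertexHom (p : P.tot) : Q.tot :=
  Q.point (component h (P.toVertices p))

lemma simplex_app {n : SimplexCategoryᵒᵖ} (q : P.simplicialTot.obj n) :
    Q.simplex (component h q) = P.simplex q :=
  congrFun (congrArg Subtype.val (NatTrans.congr_app h.map_proj n)) q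

lemma app_toVertices (p : P.tot) : component h (P.toVertices p) =
    Q.toVertices (vertexHom h p) := (Q.toVertices_point _).symm

lemma toVertices_injective : Function.Injective P.toVertices := fun _ _ e =>
  congrArg P.point e

/-- Naturality of `h` at the inclusion of vertex `i`. With `i = 0` it shows that `h` is determined
in degree zero; with `i = 1` on a 1-simplex it gives equivariance under `Γ`. -/
lemma app_vertexMap {n : SimplexCategoryᵒᵖ} (i : Fin (n.unop.len + 1))
    (q : P.simplicialTot.obj n) :
    vertexHom h (P.left.smul ((P.simplex q).edge i 0) (P.point q)) =
      Q.left.smul ((P.simplex q).edge i 0) (Q.point (component h q)) := by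
  have e := congrFun (congrArg Subtype.val (h.map.naturality (vertexMap n i))) q
  change component h ((P.simplicialTot.map (vertexMap n i)).1 q) =
    (Q.simplicialTot.map (vertexMap n i)).1 (component h q) at e
  rw [P.vertexMap_apply, Q.vertexMap_apply, app_toVertices, simplex_app] at e
  exact toVertices_injective e

lemma point_app {n : SimplexCategoryᵒᵖ} (q : P.simplicialTot.obj n) :
    Q.point (component h q) = vertexHom h (P.point q) := by
  have e := app_vertexMap h 0 q
  have e' := Q.vert_simplex (component h q)
  rw [simplex_app] at e'
  rw [P.left.edge_self_smul _ (P.vert_simplex q), Q.left.edge_self_smul _ e'] at e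
  exact e.symm

lemma proj_vertexHom (p : P.tot) : Q.proj (vertexHom h p) = P.proj p := by
  have e := Q.vert_simplex (component h (P.toVertices p))
  rw [simplex_app] at e
  exact e.symm

/-- The morphism between groupoid bundles given by a morphism between their simplicial bundles. -/
def homOfSimplicial : P ⟶ Q where
  map := vertexHom h
  smooth := (Q.point_smooth _).comp ((h.map.app _).2.comp P.toVertices_smooth)
  proj_map := proj_vertexHom h
  map_act p g := by
    have e : P.toVertices (P.act p g) =
        P.toSimplicial.act (Opposite.op ⦋0⦌) (P.toVertices p) g :=
      P.simplicialTot_ext (congrArg Simplex.const (P.principal.proj_act p g)) rfl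
    change Q.point (component h (P.toVertices (P.act p g))) = _
    rw [e]
    exact congrArg Q.point (h.map_act (Opposite.op ⦋0⦌) (P.toVertices p) g)
  map_smul γ p hp := by
    let s := Simplex.arrow γ
    have h0 : s.vert 0 = P.proj (P.left.smul γ p) := by
      rw [P.left.proj_smul _ _ hp, Simplex.arrow_vert_zero]
    have h1 : s.vert 1 = P.proj p := by
      rw [← hp, Simplex.arrow_vert_one]
    have hγ : s.edge 0 1 = γ := Simplex.arrow_edge γ
    -- The 1-simplex over `γ` with point `γ · p` over vertex `0`, the target of `γ`. Its vertex `1`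
    -- is `γ⁻¹ · (γ · p) = p`, so naturality there expresses the image of `p` as `γ⁻¹` applied to
    -- the image of `γ · p`.
    let q : P.simplicialTot.obj (Opposite.op ⦋1⦌) := ⟨(s, P.left.smul γ p), h0⟩
    have e : vertexHom h (P.left.smul (s.edge 1 0) (P.left.smul γ p)) =
        Q.left.smul (s.edge 1 0) (Q.point (component h q)) :=
      app_vertexMap h 1 q
    rw [point_app] at e
    change _ = Q.left.smul (s.edge 1 0) (vertexHom h (P.left.smul γ p)) at e
    have e1 : P.left.smul (s.edge 1 0) (P.left.smul γ p) = p := by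
      rw [← hγ, P.left.edge_smul_smul s 1 0 h1, P.left.edge_self_smul s h1]
    have h0' : s.vert 0 = Q.proj (vertexHom h (P.left.smul γ p)) :=
      h0.trans (proj_vertexHom h _).symm
    have e2 := Q.left.edge_smul_smul s 0 1 h0'
    rw [← e, e1, hγ, Q.left.edge_self_smul s h0'] at e2
    exact e2.symm

end Full

instance : (simplicialFunctor G Γ).Faithful where
  map_injective {P Q} f g hfg := Hom.ext <| funext fun p => by
    have e := congrFun (congrArg Subtype.val (NatTrans.congr_app (congrArg SimplicialBundle.Hom.map
      hfg) (Opposite.op ⦋0⦌))) (P.toVertices p)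
    exact congrArg Q.point e

instance : (simplicialFunctor G Γ).Full where
  map_surjective {P Q} h := by
    refine ⟨homOfSimplicial h, SimplicialBundle.Hom.ext ?_⟩
    ext n : 2
    refine Subtype.ext (funext fun q => ?_)
    exact Q.simplicialTot_ext (simplex_app h q).symm (point_app h q).symm

end GroupoidBundle

/-! ### Recovering a bundle over the groupoid from one over the nerve -/

/-- A principal bundle over `M` is one over any manifold diffeomorphic to `M`. -/
lemma IsPrincipalBundle.of_base_diffeo {G : Mfd.{u}} [Group G] {P M : Mfd.{u}} {π : P → M}
    {act : P → G → P} (h : IsPrincipalBundle G π act) {N : Mfd.{u}} (e : M ≃ N) (he : Smooth e)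
    (he' : Smooth e.symm) : IsPrincipalBundle G (fun p => e (π p)) act := by
  refine of_localDivision (he.comp h.proj_smooth) h.act_smooth h.act_one h.act_mul
    (fun p g => congrArg e (h.proj_act p g)) h.act_injective (fun x => ?_)
  obtain ⟨U, s, d, hx, hl, -⟩ := h.exists_localDivision (e.symm x)
  refine ⟨e.symm ⁻¹' U, fun y => s (e.symm y), d, hx, hl.isOpen.preimage he'.continuous,
    hl.section_smooth.comp he'.contMDiffOn (fun _ hy => hy), ?_, fun y hy => ?_, fun p hp => ?_⟩
  · refine hl.div_smooth.mono (fun p hp => ?_)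
    simpa using hp
  · rw [hl.proj_section _ hy, e.apply_symm_apply]
  · rw [e.symm_apply_apply]
    exact hl.act_div p (by simpa using hp)

namespace SimplicialBundle

variable {G : Mfd.{u}} [Group G] {Γ : LieGroupoid.{u}} (X : SimplicialBundle G Γ.nerve)

/-- The simplex of the nerve under a simplex of a simplicial bundle. -/
def simplex {n : SimplexCategoryᵒᵖ} (q : X.tot.obj n) : Γ.Simplex n.unop.len :=
  (X.proj.app n).1 q

/-- The vertices of a simplex of a simplicial bundle. -/
def vertex {n : SimplexCategoryᵒᵖ} (i : Fin (n.unop.len + 1)) (q : X.tot.obj n) :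
    X.tot.obj (Opposite.op ⦋0⦌) :=
  (X.tot.map (vertexMap n i)).1 q

lemma vertex_smooth {n : SimplexCategoryᵒᵖ} (i : Fin (n.unop.len + 1)) :
    Smooth (M := X.tot.obj n) (X.vertex i) := (X.tot.map (vertexMap n i)).2

lemma simplex_map {n m : SimplexCategoryᵒᵖ} (θ : n ⟶ m) (q : X.tot.obj n) :
    X.simplex ((X.tot.map θ).1 q) = (X.simplex q).comp θ.unop.toOrderHom :=
  congrFun (congrArg Subtype.val (X.proj.naturality θ)) q

lemma vertex_map {n m : SimplexCategoryᵒᵖ} (θ : n ⟶ m) (q : X.tot.obj n)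
    (i : Fin (m.unop.len + 1)) :
    X.vertex i ((X.tot.map θ).1 q) = X.vertex (θ.unop.toOrderHom i) q :=
  (congrFun (congrArg Subtype.val (X.tot.map_comp θ (vertexMap m i))) q).symm

lemma vertex_zero (p : X.tot.obj (Opposite.op ⦋0⦌)) :
    X.vertex (n := Opposite.op ⦋0⦌) 0 p = p := by
  have h : vertexMap (Opposite.op ⦋0⦌) 0 = 𝟙 _ := congrArg Quiver.Hom.op SimplexCategory.const_eq_id
  rw [vertex, h, X.tot.map_id]
  rfl

lemma act_vertex {n : SimplexCategoryᵒᵖ} (i : Fin (n.unop.len + 1)) (q : X.tot.obj n) (g : G) :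
    X.vertex i (X.act n q g) = X.act _ (X.vertex i q) g := X.map_act _ _ _

lemma simplex_act {n : SimplexCategoryᵒᵖ} (q : X.tot.obj n) (g : G) :
    X.simplex (X.act n q g) = X.simplex q := (X.principal n).proj_act q g

/-- The projection of the manifold of vertices to the objects. -/
def vertexProj (p : X.tot.obj (Opposite.op ⦋0⦌)) : Γ.obj := (X.simplex p).vert 0

lemma vertexProj_vertex {n : SimplexCategoryᵒᵖ} (i : Fin (n.unop.len + 1)) (q : X.tot.obj n) :
    X.vertexProj (X.vertex i q) = (X.simplex q).vert i :=
  congrArg (fun s : Γ.Simplex 0 => s.vert 0) (X.simplex_map (vertexMap n i) q)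

lemma vertex_principal :
    IsPrincipalBundle G X.vertexProj (X.act (Opposite.op ⦋0⦌)) := by
  let e : Γ.simplices 0 ≃ Γ.obj :=
    { toFun := fun s => Simplex.vert s 0
      invFun := Simplex.const
      left_inv := fun _ => Simplex.ext_zero rfl
      right_inv := fun _ => rfl }
  exact (X.principal (Opposite.op ⦋0⦌)).of_base_diffeo e (Γ.vert_smooth 0) const_smooth

/-- The `i`-th vertex is a morphism of principal bundles covering `s ↦ s.vert i`, hence bijective on
fibres: degree `n` is the pullback of degree `0` along any vertex. -/
lemma existsUnique_vertex_eq {n : SimplexCategoryᵒᵖ} (i : Fin (n.unop.len + 1))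
    (s : Γ.Simplex n.unop.len) {p : X.tot.obj (Opposite.op ⦋0⦌)} (h : X.vertexProj p = s.vert i) :
    ∃! q : X.tot.obj n, X.simplex q = s ∧ X.vertex i q = p :=
  (X.principal n).existsUnique_lift X.vertex_principal
    (f := fun s : Γ.Simplex n.unop.len => s.vert i)
    (X.vertexProj_vertex i) (X.act_vertex i) h

open Classical in
/-- The action of an arrow on vertices. -/
def arrowSMul (γ : Γ.arr) (p : X.tot.obj (Opposite.op ⦋0⦌)) : X.tot.obj (Opposite.op ⦋0⦌) :=
  -- The lift of the 1-simplex of `γ` ending at `p`, followed by its other vertex. The default `p`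
  -- is only reached when `src γ` is not the projection of `p`.
  if h : ∃ q : X.tot.obj (Opposite.op ⦋1⦌), X.simplex q = Simplex.arrow γ ∧ X.vertex 1 q = p
  then X.vertex 0 h.choose else p

/-- Uniqueness of the lift makes the choice in `arrowSMul` immaterial. -/
lemma arrowSMul_vertex_one (q : X.tot.obj (Opposite.op ⦋1⦌)) :
    X.arrowSMul ((X.simplex q).edge 0 1) (X.vertex 1 q) = X.vertex 0 q := by
  have hq : X.simplex q = Simplex.arrow ((X.simplex q).edge 0 1) :=
    Simplex.ext_one (Simplex.arrow_edge _).symm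
  have h : ∃ r : X.tot.obj (Opposite.op ⦋1⦌), X.simplex r =
      Simplex.arrow ((X.simplex q).edge 0 1) ∧ X.vertex 1 r = X.vertex 1 q := ⟨q, hq, rfl⟩
  have hp : X.vertexProj (X.vertex 1 q) = (X.simplex q).vert 1 := X.vertexProj_vertex 1 q
  rw [arrowSMul, dif_pos h]
  refine congrArg (X.vertex 0) ((X.existsUnique_vertex_eq (n := Opposite.op ⦋1⦌) 1 _ ?_).unique
    h.choose_spec ⟨hq, rfl⟩)
  exact hp.trans (congrArg (fun s : Γ.Simplex 1 => s.vert 1) hq)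

/-- Restrict `q` along the monotone map `[1] → [n]` with values `i`, `j`; this is where `i ≤ j` is
needed. -/
lemma arrowSMul_vertex {n : SimplexCategoryᵒᵖ} (q : X.tot.obj n) {i j : Fin (n.unop.len + 1)}
    (hij : i ≤ j) : X.arrowSMul ((X.simplex q).edge i j) (X.vertex j q) = X.vertex i q := by
  let θ : n ⟶ Opposite.op ⦋1⦌ := (SimplexCategory.mkOfLe i j hij).op
  have h := X.arrowSMul_vertex_one ((X.tot.map θ).1 q)
  rw [X.simplex_map] at h
  exact (congrArg (X.arrowSMul _) (X.vertex_map θ q 1).symm).trans (h.trans (X.vertex_map θ q 0))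

lemma arrowSMul_eq {γ : Γ.arr} {q : X.tot.obj (Opposite.op ⦋1⦌)}
    (hq : X.simplex q = Simplex.arrow γ) : X.arrowSMul γ (X.vertex 1 q) = X.vertex 0 q := by
  rw [← X.arrowSMul_vertex_one, hq, Simplex.arrow_edge]

lemma exists_arrow_vertex {γ : Γ.arr} {p : X.tot.obj (Opposite.op ⦋0⦌)}
    (h : Γ.src γ = X.vertexProj p) :
    ∃ q : X.tot.obj (Opposite.op ⦋1⦌), X.simplex q = Simplex.arrow γ ∧ X.vertex 1 q = p :=
  (X.existsUnique_vertex_eq (n := Opposite.op ⦋1⦌) 1 _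
    (h.symm.trans (Simplex.arrow_vert_one γ).symm)).exists

/-- The action of the groupoid on the vertices of a simplicial bundle over its nerve. -/
def vertexAction [LieGroup (𝓡 G.dim) ∞ G] :
    LeftAction Γ X.vertexProj X.vertex_principal.proj_smooth where
  smul := X.arrowSMul
  smul_smooth := by
    have H := fun t : fiberProduct X.vertex_principal.proj_smooth Γ.src_submersion =>
      X.exists_arrow_vertex (γ := t.1.2) (p := t.1.1) (Eq.symm t.2)
    choose c hc hc' using H
    have hval := fiberProduct_val X.vertex_principal.proj_smooth Γ.src_submersion
    -- The lift `c` was chosen pointwise, but its projection and its vertex `1` are smooth, which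
    -- makes it smooth.
    have hs : Smooth c := by
      refine (X.principal (Opposite.op ⦋1⦌)).contMDiff_of_proj_of_map X.vertex_principal
        (X.vertex_smooth 1) (X.act_vertex 1) ?_ ?_
      · exact (arrow_smooth.comp (contMDiff_snd.comp hval)).congr hc
      · exact (contMDiff_fst.comp hval).congr hc'
    refine ((X.vertex_smooth (n := Opposite.op ⦋1⦌) 0).comp hs).congr (fun t => ?_)
    exact (congrArg (X.arrowSMul _) (hc' t).symm).trans (X.arrowSMul_eq (hc t))
  proj_smul γ p h := by
    obtain ⟨q, hq, rfl⟩ := X.exists_arrow_vertex h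
    rw [X.arrowSMul_eq hq, X.vertexProj_vertex, hq]
    exact Simplex.arrow_vert_zero γ
  unit_smul p := by
    have h := X.arrowSMul_vertex (n := Opposite.op ⦋0⦌) p (le_refl 0)
    rw [X.vertex_zero, Simplex.edge_self] at h
    exact h
  mul_smul γ₁ γ₂ p h h' := by
    have hv : (Simplex.arrow γ₁).vert (Fin.last 1) = Γ.tgt γ₂ :=
      (Simplex.arrow_vert_one γ₁).trans h'
    -- Lift the 2-simplex `(γ₁, γ₂)` so that it ends at `p`. Its edges `12`, `01` and `02` compute
    -- the actions of `γ₂`, `γ₁` and `γ₁γ₂`.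
    let s : Γ.Simplex 2 := (Simplex.arrow γ₁).snoc γ₂ hv
    have h12 : s.edge 1 2 = γ₂ :=
      ((Simplex.arrow γ₁).snoc_edge_star γ₂ hv 2).trans (Simplex.snocStar_last _ _)
    have h01 : s.edge 0 1 = γ₁ :=
      (congrArg (fun t : Γ.Simplex 1 => t.edge 0 1) ((Simplex.arrow γ₁).snoc_init γ₂ hv)).trans
        (Simplex.arrow_edge γ₁)
    have h02 : s.edge 0 2 = Γ.mul γ₁ γ₂ := by rw [← s.edge_mul 0 1 2, h01, h12]
    have hp : X.vertexProj p = s.vert 2 := by rw [← h, ← h12, s.src_edge]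
    obtain ⟨q, hq, rfl⟩ := (X.existsUnique_vertex_eq (n := Opposite.op ⦋2⦌) 2 s hp).exists
    have e12 := X.arrowSMul_vertex q (i := (1 : Fin 3)) (j := (2 : Fin 3)) (by decide)
    have e01 := X.arrowSMul_vertex q (i := (0 : Fin 3)) (j := (1 : Fin 3)) (by decide)
    have e02 := X.arrowSMul_vertex q (i := (0 : Fin 3)) (j := (2 : Fin 3)) (by decide)
    rw [hq] at e12 e01 e02
    rw [← h02, e02, ← e01, ← e12, h12, h01]

/-- The principal bundle over a groupoid given by one over its nerve. -/
def toGroupoidBundle [LieGroup (𝓡 G.dim) ∞ G] : GroupoidBundle G Γ where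
  tot := X.tot.obj (Opposite.op ⦋0⦌)
  proj := X.vertexProj
  act := X.act _
  principal := X.vertex_principal
  left := X.vertexAction
  smul_act γ p g h := by
    obtain ⟨q, hq, rfl⟩ := X.exists_arrow_vertex h
    -- Translating a lift of `γ` by `g` gives another lift of `γ`, with both vertices translated.
    have hq' : X.simplex (X.act _ q g) = Simplex.arrow γ := by rw [X.simplex_act, hq]
    have e := X.arrowSMul_eq hq'
    rw [X.act_vertex, X.act_vertex] at e
    change X.act _ (X.arrowSMul γ _) g = X.arrowSMul γ _
    rw [e, X.arrowSMul_eq hq]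

section Iso

variable [LieGroup (𝓡 G.dim) ∞ G]

/-- The comparison of a simplicial bundle with the one that comes from its vertices. -/
def compare (n : SimplexCategoryᵒᵖ) (q : X.tot.obj n) :
    X.toGroupoidBundle.simplicialTot.obj n :=
  ⟨(X.simplex q, X.vertex 0 q), (X.vertexProj_vertex 0 q).symm⟩

lemma compare_smooth (n : SimplexCategoryᵒᵖ) : Smooth (X.compare n) :=
  fiberProduct_lift _ _ ((X.proj.app n).2.prodMk (X.vertex_smooth 0))

/-- The monotone edge `0 → i` is covered by `arrowSMul_vertex`; its inverse reverses the transport.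
This is the naturality of `compare`. -/
lemma smul_vertex_zero {n : SimplexCategoryᵒᵖ} (q : X.tot.obj n) (i : Fin (n.unop.len + 1)) :
    X.vertexAction.smul ((X.simplex q).edge i 0) (X.vertex 0 q) = X.vertex i q := by
  have h := X.vertexProj_vertex i q
  have e : X.vertexAction.smul ((X.simplex q).edge 0 i) (X.vertex i q) = X.vertex 0 q :=
    X.arrowSMul_vertex q (Fin.zero_le i)
  rw [← e, X.vertexAction.edge_smul_smul _ _ _ h.symm, X.vertexAction.edge_self_smul _ h.symm]

/-- The comparison is a morphism of simplicial bundles. -/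
def compareHom : X ⟶ X.toGroupoidBundle.toSimplicial where
  map :=
    { app := fun n => ⟨X.compare n, X.compare_smooth n⟩
      naturality := fun n m θ => Subtype.ext (funext fun q => by
        refine X.toGroupoidBundle.simplicialTot_ext (X.simplex_map θ q) ?_
        exact (X.vertex_map θ q 0).trans (X.smul_vertex_zero q _).symm) }
  map_proj := rfl
  map_act n q g := X.toGroupoidBundle.simplicialTot_ext (X.simplex_act q g) (X.act_vertex 0 q g)

lemma compare_bijective (n : SimplexCategoryᵒᵖ) : Function.Bijective (X.compare n) := by
  refine (Function.bijective_iff_existsUnique _).2 (fun r => ?_)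
  obtain ⟨q, ⟨hq, hq'⟩, hu⟩ := X.existsUnique_vertex_eq (n := n) 0
    (X.toGroupoidBundle.simplex r) (X.toGroupoidBundle.vert_simplex r).symm
  refine ⟨q, X.toGroupoidBundle.simplicialTot_ext hq hq', fun y hy => hu y ⟨?_, ?_⟩⟩
  · exact congrArg X.toGroupoidBundle.simplex hy
  · exact congrArg X.toGroupoidBundle.point hy

end Iso

end SimplicialBundle

/-! ### Degreewise bijective morphisms, and the first equivalence -/

namespace SimplicialBundle

variable {G : Mfd.{u}} [Group G] {X : SimplicialObject Mfd.{u}}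

/-- A morphism of simplicial principal bundles that is bijective in each degree is an
isomorphism. -/
lemma isIso_of_bijective [LieGroup (𝓡 G.dim) ∞ G] {P Q : SimplicialBundle G X} (f : P ⟶ Q)
    (h : ∀ n, Function.Bijective (f.map.app n).1) : IsIso f := by
  have hproj : ∀ n p, (Q.proj.app n).1 ((f.map.app n).1 p) = (P.proj.app n).1 p := fun n p =>
    congrFun (congrArg Subtype.val (NatTrans.congr_app f.map_proj n)) p
  let e := fun n => Equiv.ofBijective _ (h n)
  have he : ∀ n r, (f.map.app n).1 ((e n).symm r) = r := fun n r => (e n).apply_symm_apply r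
  have he' : ∀ n p, (e n).symm ((f.map.app n).1 p) = p := fun n p => (e n).symm_apply_apply p
  -- The composites of the inverse with the projection and with `f` are smooth, so the inverse is.
  have hs : ∀ n, Smooth (e n).symm := fun n => by
    refine (P.principal n).contMDiff_of_proj_of_map (Q.principal n) (f.map.app n).2
      (f.map_act n) ?_ ?_
    · exact (Q.proj.app n).2.congr (fun r => by rw [← hproj, he])
    · exact contMDiff_id.congr (he n)
  refine ⟨⟨⟨{ app := fun n => ⟨(e n).symm, hs n⟩, naturality := ?_ }, ?_, ?_⟩, ?_, ?_⟩⟩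
  · intro n m θ
    refine Subtype.ext (funext fun r => (h m).1 ?_)
    have hn := congrFun (congrArg Subtype.val (f.map.naturality θ)) ((e n).symm r)
    change (f.map.app m).1 ((P.tot.map θ).1 _) = (Q.tot.map θ).1 ((f.map.app n).1 _) at hn
    change (f.map.app m).1 ((e m).symm ((Q.tot.map θ).1 r)) =
      (f.map.app m).1 ((P.tot.map θ).1 ((e n).symm r))
    rw [he, hn, he]
  · ext n : 2
    refine Subtype.ext (funext fun r => ?_)
    change (P.proj.app n).1 ((e n).symm r) = (Q.proj.app n).1 r
    rw [← hproj, he]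
  · intro n r g
    refine (h n).1 ?_
    change (f.map.app n).1 ((e n).symm (Q.act n r g)) =
      (f.map.app n).1 (P.act n ((e n).symm r) g)
    rw [he, f.map_act, he]
  · refine Hom.ext ?_
    ext n : 2
    exact Subtype.ext (funext (he' n))
  · refine Hom.ext ?_
    ext n : 2
    exact Subtype.ext (funext (he n))

end SimplicialBundle

section Equivalence

variable {G : Mfd.{u}} [Group G] {Γ : LieGroupoid.{u}}

instance [LieGroup (𝓡 G.dim) ∞ G] : (GroupoidBundle.simplicialFunctor G Γ).EssSurj where
  mem_essImage X := by
    have := SimplicialBundle.isIso_of_bijective X.compareHom X.compare_bijective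
    exact ⟨X.toGroupoidBundle, ⟨(asIso X.compareHom).symm⟩⟩

instance [LieGroup (𝓡 G.dim) ∞ G] : (GroupoidBundle.simplicialFunctor G Γ).IsEquivalence where

end Equivalence

/-! ### Injective smooth maps are immersive somewhere -/

section Analysis

variable {E F : Type*} [NormedAddCommGroup E] [NormedSpace ℝ E] [FiniteDimensional ℝ E]
  [NormedAddCommGroup F] [NormedSpace ℝ F] [FiniteDimensional ℝ F]

open Filter Topology

/-- A smooth map whose derivative is injective between spaces of the same dimension has a smooth
local right inverse. -/
lemma exists_local_rightInverse {f : E → F} {x : E} (hf : ContDiffAt ℝ ∞ f x)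
    (hinj : Function.Injective (fderiv ℝ f x)) (hd : Module.finrank ℝ E = Module.finrank ℝ F) :
    ∃ k : F → E, ContDiffAt ℝ ∞ k (f x) ∧ k (f x) = x ∧ ∀ᶠ y in 𝓝 (f x), f (k y) = y := by
  have : CompleteSpace E := FiniteDimensional.complete ℝ E
  let L : E ≃L[ℝ] F :=
    (LinearMap.linearEquivOfInjective (fderiv ℝ f x).toLinearMap hinj hd).toContinuousLinearEquiv
  have hL : HasFDerivAt f (L : E →L[ℝ] F) x := by
    have h : (L : E →L[ℝ] F) = fderiv ℝ f x := ContinuousLinearMap.ext fun _ => rfl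
    rw [h]
    exact (hf.differentiableAt (by simp)).hasFDerivAt
  exact ⟨hf.localInverse hL (by simp), hf.to_localInverse hL (by simp),
    hf.localInverse_apply_image hL (by simp),
    (hf.hasStrictFDerivAt' hL (by simp)).eventually_right_inverse⟩

/-- An injective smooth map has an injective derivative at some point (where its rank is
maximal). -/
lemma exists_injective_fderiv {f : E → F} {U : Set E} (hU : IsOpen U) (hne : U.Nonempty)
    (hf : ContDiffOn ℝ ∞ f U) (hinj : Set.InjOn f U) :
    ∃ x ∈ U, Function.Injective (fderiv ℝ f x) := by
  have : CompleteSpace E := FiniteDimensional.complete ℝ E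
  -- The argument is that of the constant rank theorem: at a point of maximal rank, a kernel
  -- direction would yield a curve along which `f` is constant.
  let rk : E → ℕ := fun x => Module.finrank ℝ (fderiv ℝ f x).range
  have hbdd : BddAbove (rk '' U) := ⟨Module.finrank ℝ F, by
    rintro _ ⟨z, -, rfl⟩
    exact Submodule.finrank_le _⟩
  obtain ⟨x, hx, hrx⟩ := Nat.sSup_mem (hne.image rk) hbdd
  have hmax : ∀ z ∈ U, rk z ≤ rk x := fun z hz => hrx ▸ le_csSup hbdd ⟨z, hz, rfl⟩
  refine ⟨x, hx, ?_⟩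
  have hfU : ∀ z ∈ U, ContDiffAt ℝ ∞ f z := fun z hz => hf.contDiffAt (hU.mem_nhds hz)
  let A := fderiv ℝ f x
  obtain ⟨p', hp'⟩ := LinearMap.exists_leftInverse_of_injective A.range.subtype
    (Submodule.ker_subtype _)
  obtain ⟨q', hq'⟩ := LinearMap.exists_leftInverse_of_injective A.ker.subtype
    (Submodule.ker_subtype _)
  let p : F →L[ℝ] A.range := p'.toContinuousLinearMap
  let q : E →L[ℝ] A.ker := q'.toContinuousLinearMap
  have hp : ∀ y : A.range, p y = y := fun y => LinearMap.congr_fun hp' y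
  have hq : ∀ y : A.ker, q y = y := fun y => LinearMap.congr_fun hq' y
  -- With `p` and `q` retractions onto the range and kernel of `A`, this completes `p ∘ f` to a map
  -- whose derivative at `x` is bijective.
  let g : E → A.range × A.ker := fun z => (p (f z), q z)
  have hg : ∀ z ∈ U, ContDiffAt ℝ ∞ g z := fun z hz =>
    (p.contDiff.contDiffAt.comp z (hfU z hz)).prodMk q.contDiff.contDiffAt
  have hg' : ∀ z ∈ U, HasFDerivAt g ((p.comp (fderiv ℝ f z)).prod q) z := fun z hz =>
    (p.hasFDerivAt.comp z ((hfU z hz).differentiableAt (by simp)).hasFDerivAt).prodMk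
      q.hasFDerivAt
  have hginj : Function.Injective (fderiv ℝ g x) := by
    rw [(hg' x hx).fderiv, injective_iff_map_eq_zero]
    intro v hv
    have h1 : p (A v) = 0 := congrArg Prod.fst hv
    have h2 : q v = 0 := congrArg Prod.snd hv
    have h3 : A v = 0 := by
      have := hp ⟨A v, LinearMap.mem_range_self _ v⟩
      rw [h1] at this
      exact (congrArg Subtype.val this).symm
    have h4 := hq ⟨v, h3⟩
    rw [h2] at h4
    exact (congrArg Subtype.val h4).symm
  have hdim : Module.finrank ℝ E = Module.finrank ℝ (A.range × A.ker) := by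
    rw [Module.finrank_prod]
    exact (LinearMap.finrank_range_add_finrank_ker A.toLinearMap).symm
  obtain ⟨k, hk, hkx, hgk⟩ := exists_local_rightInverse (hg x hx) hginj hdim
  rw [injective_iff_map_eq_zero]
  intro v hv
  let w : A.ker := ⟨v, hv⟩
  -- Along `k ∘ l` only the kernel coordinate of `g` moves, so `p ∘ f` has zero derivative there.
  let l : ℝ → A.range × A.ker := fun t => g x + t • (0, w)
  have hl : Continuous l := by fun_prop
  have hl0 : l 0 = g x := by simp [l]
  have hlt : Tendsto l (𝓝 0) (𝓝 (g x)) := hl0 ▸ hl.tendsto 0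
  have hgood : ∀ᶠ z in 𝓝 x, z ∈ U ∧
      Function.Surjective ((p.comp (fderiv ℝ f z)).prod q : E → A.range × A.ker) := by
    have hc : ContinuousAt (fderiv ℝ g) x := ((hg x hx).fderiv_right (m := 0) (by simp)).continuousAt
    let L : E ≃L[ℝ] A.range × A.ker :=
      (LinearMap.linearEquivOfInjective (fderiv ℝ g x).toLinearMap hginj
        hdim).toContinuousLinearEquiv
    have hL : (L : E →L[ℝ] A.range × A.ker) = fderiv ℝ g x := ContinuousLinearMap.ext fun _ => rfl
    filter_upwards [hU.mem_nhds hx, hc.preimage_mem_nhds (hL ▸ L.nhds)] with z hz hz'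
    obtain ⟨L', hL'⟩ := hz'
    refine ⟨hz, ?_⟩
    rw [← (hg' z hz).fderiv, ← hL']
    exact L'.surjective
  have hkt : Tendsto (fun t => k (l t)) (𝓝 0) (𝓝 x) := by
    have := hk.continuousAt.tendsto.comp hlt
    rwa [hkx] at this
  have hk1 : ∀ᶠ y in 𝓝 (g x), DifferentiableAt ℝ k y := by
    have h1 : ContDiffAt ℝ 1 k (g x) := hk.of_le (by norm_cast)
    filter_upwards [h1.eventually (by simp)] with y hy
    exact hy.differentiableAt (by simp)
  obtain ⟨ε, hε, hall⟩ := Metric.eventually_nhds_iff_ball.1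
    ((hkt.eventually hgood).and ((hlt.eventually hk1).and (hlt.eventually hgk)))
  have hderiv : ∀ t ∈ Metric.ball (0 : ℝ) ε, HasDerivAt (fun t => f (k (l t))) 0 t := by
    intro t ht
    obtain ⟨⟨hzU, hsurj⟩, hkd, -⟩ := hall t ht
    have hld : HasDerivAt l (0, w) t := by
      have h := ((hasDerivAt_id t).smul_const ((0, w) : A.range × A.ker)).const_add (g x)
      rwa [one_smul] at h
    have hcd : HasDerivAt (fun t => k (l t)) (fderiv ℝ k (l t) (0, w)) t :=
      hkd.hasFDerivAt.comp_hasDerivAt t hld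
    have hgd : HasDerivAt (fun t => g (k (l t))) _ t := (hg' _ hzU).comp_hasDerivAt t hcd
    have hgd' : HasDerivAt (fun t => g (k (l t))) (0, w) t := by
      refine hld.congr_of_eventuallyEq ?_
      filter_upwards [Metric.isOpen_ball.mem_nhds ht] with t' ht'
      exact (hall t' ht').2.2
    have hfd : HasDerivAt (fun t => f (k (l t))) _ t :=
      (((hfU _ hzU).differentiableAt (by simp)).hasFDerivAt).comp_hasDerivAt t hcd
    have hp0 : p (fderiv ℝ f (k (l t)) (fderiv ℝ k (l t) (0, w))) = 0 :=
      congrArg Prod.fst (hgd.unique hgd')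
    -- Near `x` the map `p` sends the range of the derivative of `f` onto `A.range`. Maximality of
    -- the rank at `x` makes the dimensions equal, so `p` is injective on that range and kills no
    -- nonzero velocity of `f`.
    have hpinj : Function.Injective
        (p.toLinearMap.domRestrict (fderiv ℝ f (k (l t))).range) := by
      have hs : Function.Surjective
          (p.toLinearMap.domRestrict (fderiv ℝ f (k (l t))).range) := by
        intro y
        obtain ⟨u, hu⟩ := hsurj (y, 0)
        exact ⟨⟨_, LinearMap.mem_range_self _ u⟩, congrArg Prod.fst hu⟩
      refine (LinearMap.injective_iff_surjective_of_finrank_eq_finrank ?_).2 hs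
      exact le_antisymm (hmax _ hzU) (LinearMap.finrank_le_finrank_of_surjective hs)
    have h0 : fderiv ℝ f (k (l t)) (fderiv ℝ k (l t) (0, w)) = 0 :=
      congrArg Subtype.val ((injective_iff_map_eq_zero _).1 hpinj
        ⟨_, LinearMap.mem_range_self (fderiv ℝ f (k (l t))).toLinearMap _⟩ hp0)
    rwa [h0] at hfd
  have hmem : ε / 2 ∈ Metric.ball (0 : ℝ) ε := by
    rw [Metric.mem_ball, dist_zero_right, Real.norm_of_nonneg (by positivity)]
    linarith
  have h0mem : (0 : ℝ) ∈ Metric.ball (0 : ℝ) ε := Metric.mem_ball_self hε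
  have hconst : f (k (l (ε / 2))) = f (k (l 0)) :=
    Metric.isOpen_ball.is_const_of_deriv_eq_zero (convex_ball _ _).isPreconnected
      (fun t ht => (hderiv t ht).differentiableAt.differentiableWithinAt)
      (fun t ht => (hderiv t ht).deriv) hmem h0mem
  have hkl : k (l (ε / 2)) = k (l 0) := hinj (hall _ hmem).1.1 (hall _ h0mem).1.1 hconst
  have hll : l (ε / 2) = l 0 := by
    rw [← (hall _ hmem).2.2, hkl, (hall _ h0mem).2.2]
  have hw : (ε / 2) • w = 0 := by
    have := congrArg Prod.snd hll
    simpa [l] using this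
  have hw0 : w = 0 := (smul_eq_zero.1 hw).resolve_left (by positivity)
  exact congrArg Subtype.val hw0

end Analysis

/-! ### Immersions, dimension and local inverses on manifolds -/

section Manifolds

open Filter Topology

variable {E : Type*} [NormedAddCommGroup E] [NormedSpace ℝ E]
  {F : Type*} [NormedAddCommGroup F] [NormedSpace ℝ F]
  {H : Type*} [TopologicalSpace H] {I : ModelWithCorners ℝ E H}
  {K : Type*} [TopologicalSpace K] {J : ModelWithCorners ℝ F K}
  {M : Type*} [TopologicalSpace M] [ChartedSpace H M]
  {N : Type*} [TopologicalSpace N] [ChartedSpace K N]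

section Comp

variable {E' : Type*} [NormedAddCommGroup E'] [NormedSpace ℝ E']
  {H' : Type*} [TopologicalSpace H'] {I' : ModelWithCorners ℝ E' H'}
  {M' : Type*} [TopologicalSpace M'] [ChartedSpace H' M']

lemma mfderiv_injective_of_comp {f : M → N} {g : N → M'} {h : M → M'} {x : M}
    (hg : MDifferentiableAt J I' g (f x)) (hf : MDifferentiableAt I J f x)
    (hh : g ∘ f =ᶠ[𝓝 x] h) (hi : Function.Injective (mfderiv I I' h x)) :
    Function.Injective (mfderiv I J f x) := by
  rw [← hh.mfderiv_eq, mfderiv_comp x hg hf] at hi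
  exact Function.Injective.of_comp hi

lemma mfderiv_injective_comp {f : M → N} {g : N → M'} {x : M}
    (hg : MDifferentiableAt J I' g (f x)) (hf : MDifferentiableAt I J f x)
    (hgi : Function.Injective (mfderiv J I' g (f x)))
    (hfi : Function.Injective (mfderiv I J f x)) :
    Function.Injective (mfderiv I I' (g ∘ f) x) := by
  rw [mfderiv_comp x hg hf]
  exact hgi.comp hfi

lemma mfderiv_injective_of_leftInverse {f : M → N} {g : N → M} {x : M}
    (hg : MDifferentiableAt J I g (f x)) (hf : MDifferentiableAt I J f x)
    (hh : g ∘ f =ᶠ[𝓝 x] id) : Function.Injective (mfderiv I J f x) := by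
  refine mfderiv_injective_of_comp hg hf hh ?_
  rw [mfderiv_id]
  exact fun _ _ h => h

end Comp

variable [FiniteDimensional ℝ E] [FiniteDimensional ℝ F] [I.Boundaryless]

/-- A smooth map that increases the dimension cannot have an image with interior points. -/
lemma interior_image_eq_empty_of_finrank_lt [J.Boundaryless] [SecondCountableTopology M]
    [IsManifold I ∞ M] [IsManifold J ∞ N] {f : M → N} {S : Set M} (hS : IsOpen S) (hf : ContMDiffOn I J ∞ f S)
    (hd : Module.finrank ℝ E < Module.finrank ℝ F) : interior (f '' S) = ∅ := by
  rw [Set.eq_empty_iff_forall_notMem]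
  intro y hy
  let ψ := extChartAt J y
  let D : M → Set E := fun x => (extChartAt I x).target ∩ (extChartAt I x).symm ⁻¹'
    (S ∩ f ⁻¹' ψ.source)
  obtain ⟨T, hT, hcover⟩ := TopologicalSpace.countable_cover_nhds
    (fun x : M => extChartAt_source_mem_nhds (I := I) x)
  -- The image read in the chart at `y`, as a countable union of locally Lipschitz images of subsets
  -- of `E`. Its Hausdorff dimension is at most that of `E`, whereas a neighbourhood in `F` has that
  -- of `F`.
  let B : Set F := ⋃ x ∈ T, (fun e => ψ (f ((extChartAt I x).symm e))) '' D x
  have hB : dimH B ≤ Module.finrank ℝ E := by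
    rw [dimH_bUnion hT]
    refine iSup₂_le fun x _ => ?_
    refine (dimH_image_le_of_locally_lipschitzOn fun e he => ?_).trans
      ((dimH_mono (Set.subset_univ _)).trans_eq (Real.dimH_univ_eq_finrank E))
    have h1 : ContMDiffAt 𝓘(ℝ, E) I ∞ (extChartAt I x).symm e :=
      (contMDiffOn_extChartAt_symm x).contMDiffAt ((isOpen_extChartAt_target x).mem_nhds he.1)
    have h2 : ContMDiffAt I J ∞ f ((extChartAt I x).symm e) :=
      hf.contMDiffAt (hS.mem_nhds he.2.1)
    have h3 : ContMDiffAt J 𝓘(ℝ, F) ∞ ψ (f ((extChartAt I x).symm e)) :=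
      (contMDiffOn_extChartAt (x := y)).contMDiffAt ((chartAt K y).open_source.mem_nhds
        (by simpa [ψ] using he.2.2))
    have h4 := (contMDiffAt_iff_contDiffAt.1 (h3.comp e (h2.comp e h1))).of_le
      (show (1 : WithTop ℕ∞) ≤ ∞ by norm_cast)
    obtain ⟨C, t, ht, hC⟩ := (h4.hasStrictFDerivAt (by simp)).exists_lipschitzOnWith
    exact ⟨C, t, mem_nhdsWithin_of_mem_nhds ht, hC⟩
  have hint : B ∈ 𝓝 (ψ y) := by
    have h1 : ψ.target ∩ ψ.symm ⁻¹' (interior (f '' S)) ∈ 𝓝 (ψ y) := by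
      refine inter_mem ((isOpen_extChartAt_target y).mem_nhds (mem_extChartAt_target y)) ?_
      refine (continuousAt_extChartAt_symm y).preimage_mem_nhds ?_
      rw [extChartAt_to_inv]
      exact isOpen_interior.mem_nhds hy
    refine mem_of_superset h1 ?_
    rintro z ⟨hz, hz'⟩
    obtain ⟨m, hm, hmz⟩ := interior_subset hz'
    obtain ⟨x, hxT, hx⟩ := Set.mem_iUnion₂.1 (hcover ▸ Set.mem_univ m)
    have hinv := (extChartAt I x).left_inv hx
    refine Set.mem_iUnion₂.2 ⟨x, hxT, extChartAt I x m, ⟨(extChartAt I x).map_source hx, ?_⟩, ?_⟩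
    · rw [Set.mem_preimage, hinv]
      refine ⟨hm, ?_⟩
      rw [Set.mem_preimage, hmz]
      exact ψ.map_target hz
    · change ψ (f ((extChartAt I x).symm _)) = z
      rw [hinv, hmz, ψ.right_inv hz]
  have hF := Real.dimH_of_mem_nhds hint
  rw [hF] at hB
  exact absurd (by exact_mod_cast hB) hd.not_ge

/-- The inverse function theorem on manifolds. -/
lemma exists_contMDiffAt_rightInverse [IsManifold I ∞ M] [IsManifold J ∞ N] {f : M → N} {x : M}
    (hf : ContMDiffAt I J ∞ f x) (hinj : Function.Injective (mfderiv I J f x))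
    (hd : Module.finrank ℝ E = Module.finrank ℝ F) :
    ∃ k : N → M, ContMDiffAt J I ∞ k (f x) ∧ k (f x) = x ∧ ∀ᶠ y in 𝓝 (f x), f (k y) = y := by
  let φ := extChartAt I x
  let ψ := extChartAt J (f x)
  let g : E → F := fun e => ψ (f (φ.symm e))
  have hgx : g (φ x) = ψ (f x) := by
    change ψ (f (φ.symm (φ x))) = _
    rw [extChartAt_to_inv]
  have hg : ContDiffAt ℝ ∞ g (φ x) := by
    have h := (contMDiffAt_iff.1 hf).2
    rw [I.range_eq_univ, contDiffWithinAt_univ] at h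
    exact h
  have hg' : Function.Injective (fderiv ℝ g (φ x)) := by
    rw [(hf.mdifferentiableAt (by simp)).mfderiv] at hinj
    change Function.Injective (fderivWithin ℝ g (Set.range I) (φ x)) at hinj
    rwa [I.range_eq_univ, fderivWithin_univ] at hinj
  obtain ⟨k, hk, hkx, hgk⟩ := exists_local_rightInverse hg hg' hd
  rw [hgx] at hk hkx hgk
  have hψ : ContMDiffAt J 𝓘(ℝ, F) ∞ ψ (f x) := contMDiffAt_extChartAt
  have hφ : ContMDiffAt 𝓘(ℝ, E) I ∞ φ.symm (k (ψ (f x))) := by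
    rw [hkx]
    exact (contMDiffOn_extChartAt_symm x).contMDiffAt (extChartAt_target_mem_nhds x)
  have hK : ContMDiffAt J I ∞ (fun y => φ.symm (k (ψ y))) (f x) :=
    hφ.comp (f x) (hk.contMDiffAt.comp (f x) hψ)
  have hKx : φ.symm (k (ψ (f x))) = x := by rw [hkx, extChartAt_to_inv]
  refine ⟨fun y => φ.symm (k (ψ y)), hK, hKx, ?_⟩
  have hfK : ContinuousAt (fun y => f (φ.symm (k (ψ y)))) (f x) :=
    ContinuousAt.comp (f := fun y => φ.symm (k (ψ y))) (by rw [hKx]; exact hf.continuousAt)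
      hK.continuousAt
  have hsrc : ψ.source ∈ 𝓝 (f (φ.symm (k (ψ (f x))))) := by
    rw [hKx]
    exact extChartAt_source_mem_nhds _
  filter_upwards [extChartAt_source_mem_nhds (I := J) (f x), hfK.preimage_mem_nhds hsrc,
    hψ.continuousAt.eventually hgk] with y hy hy' hyk
  exact ψ.injOn hy' hy hyk

end Manifolds

namespace Mfd

open Filter Topology

variable {M N : Mfd.{u}}

/-- An injective smooth map is immersive at some point. -/
lemma exists_injective_mfderiv [Nonempty M] {f : M → N} (hf : Smooth f)
    (hinj : Function.Injective f) :
    ∃ x, Function.Injective (mfderiv (𝓡 M.dim) (𝓡 N.dim) f x) := by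
  obtain ⟨x₀⟩ := ‹Nonempty M›
  let φ := chartAt (EuclideanSpace ℝ (Fin M.dim)) x₀
  let ψ := chartAt (EuclideanSpace ℝ (Fin N.dim)) (f x₀)
  have hψ : ContMDiffOn (𝓡 N.dim) (𝓡 N.dim) ∞ ψ ψ.source := contMDiffOn_chart
  have hφ : ContMDiffOn (𝓡 M.dim) (𝓡 M.dim) ∞ φ φ.source := contMDiffOn_chart
  have hφ' : ContMDiffOn (𝓡 M.dim) (𝓡 M.dim) ∞ φ.symm φ.target := contMDiffOn_chart_symm
  let U : Set (EuclideanSpace ℝ (Fin M.dim)) := φ.target ∩ φ.symm ⁻¹' (f ⁻¹' ψ.source)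
  have hU : IsOpen U := φ.continuousOn_symm.isOpen_inter_preimage φ.open_target
    (ψ.open_source.preimage hf.continuous)
  have hUne : U.Nonempty := by
    refine ⟨φ x₀, mem_chart_target _ _, ?_⟩
    rw [Set.mem_preimage, φ.left_inv (mem_chart_source _ _)]
    exact mem_chart_source _ _
  let g := fun e => ψ (f (φ.symm e))
  have hg : ContMDiffOn (𝓡 M.dim) (𝓡 N.dim) ∞ g U :=
    hψ.comp (hf.comp_contMDiffOn (hφ'.mono (fun _ he => he.1))) (fun _ he => he.2)
  obtain ⟨e, he, hei⟩ := exists_injective_fderiv hU hUne (contMDiffOn_iff_contDiffOn.1 hg)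
    (fun a ha b hb hab => φ.symm.injOn ha.1 hb.1 (hinj (ψ.injOn ha.2 hb.2 hab)))
  have hes : φ.symm e ∈ φ.source := φ.map_target he.1
  have hee : φ (φ.symm e) = e := φ.right_inv he.1
  have hφe : MDifferentiableAt (𝓡 M.dim) (𝓡 M.dim) φ (φ.symm e) :=
    (hφ.contMDiffAt (φ.open_source.mem_nhds hes)).mdifferentiableAt (by simp)
  have hφi : Function.Injective (mfderiv (𝓡 M.dim) (𝓡 M.dim) φ (φ.symm e)) := by
    refine mfderiv_injective_of_leftInverse (g := φ.symm) ?_ hφe ?_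
    · rw [hee]
      exact (hφ'.contMDiffAt (φ.open_target.mem_nhds he.1)).mdifferentiableAt (by simp)
    · filter_upwards [φ.open_source.mem_nhds hes] with m hm
      exact φ.left_inv hm
  have hgd : MDifferentiableAt (𝓡 M.dim) (𝓡 N.dim) g (φ (φ.symm e)) := by
    rw [hee]
    exact (hg.contMDiffAt (hU.mem_nhds he)).mdifferentiableAt (by simp)
  have hgi : Function.Injective (mfderiv (𝓡 M.dim) (𝓡 N.dim) g (φ (φ.symm e))) := by
    rw [hee, mfderiv_eq_fderiv]
    exact hei
  refine ⟨φ.symm e, mfderiv_injective_of_comp (g := ψ) (h := g ∘ φ) ?_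
    (hf.contMDiffAt.mdifferentiableAt (by simp)) ?_ (mfderiv_injective_comp hgd hφe hgi hφi)⟩
  · exact (hψ.contMDiffAt (ψ.open_source.mem_nhds he.2)).mdifferentiableAt (by simp)
  · filter_upwards [φ.open_source.mem_nhds hes] with m hm
    change ψ (f m) = ψ (f (φ.symm (φ m)))
    rw [φ.left_inv hm]

/-- A surjective submersion has smooth local sections. -/
lemma exists_local_section {π : N → M} (hπ : Submersion π) (hs : Function.Surjective π) (x : M) :
    ∃ (U : Set M) (s : M → N), IsOpen U ∧ x ∈ U ∧ ContMDiffOn (𝓡 M.dim) (𝓡 N.dim) ∞ s U ∧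
      ∀ y ∈ U, π (s y) = y := by
  obtain ⟨z, rfl⟩ := hs x
  -- A point of the fibre product along the identity, introduced only to reuse the adapted charts
  -- `fpDom` and `fpCod`. The section keeps the complementary coordinate fixed at its value `v` at
  -- `z`.
  let q : FP (id : M → M) π := ⟨(π z, z), rfl⟩
  let h := hπ.isSubmersionOfComplement_complement z
  let v := (fpSplit hπ q (fpDom hπ q z)).2
  let a : M → EuclideanSpace ℝ (Fin N.dim) := fun y => (fpSplit hπ q).symm (fpCod hπ q y, v)
  have hz : z ∈ (fpDom hπ q).source := h.mem_domChart_source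
  have ha : ContMDiffOn (𝓡 M.dim) (𝓡 N.dim) ∞ a (fpCod hπ q).source := by
    have h1 : ContMDiffOn (𝓡 M.dim) 𝓘(ℝ, EuclideanSpace ℝ (Fin M.dim)) ∞ (fpCod hπ q)
        (fpCod hπ q).source := contMDiffOn_of_mem_maximalAtlas h.codChart_mem_maximalAtlas
    exact (fpSplit hπ q).symm.toContinuousLinearMap.contMDiff.comp_contMDiffOn
      (h1.prodMk_space contMDiffOn_const)
  have haz : a (π z) = fpDom hπ q z := by
    have := fp_written hπ q ((fpDom hπ q).map_source hz)
    rw [(fpDom hπ q).left_inv hz] at this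
    change (fpSplit hπ q).symm (fpCod hπ q (π z), v) = _
    rw [this, Prod.mk.eta, ContinuousLinearEquiv.symm_apply_apply]
  refine ⟨(fpCod hπ q).source ∩ a ⁻¹' (fpDom hπ q).target, fun y => (fpDom hπ q).symm (a y),
    ha.continuousOn.isOpen_inter_preimage (fpCod hπ q).open_source (fpDom hπ q).open_target,
    ⟨h.mem_codChart_source, ?_⟩, ?_, ?_⟩
  · rw [Set.mem_preimage, haz]
    exact (fpDom hπ q).map_source hz
  · exact (contMDiffOn_symm_of_mem_maximalAtlas h.domChart_mem_maximalAtlas).comp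
      (ha.mono (fun _ hy => hy.1)) (fun _ hy => hy.2)
  · intro y hy
    refine (fpCod hπ q).injOn (fp_maps hπ q ((fpDom hπ q).map_target hy.2)) hy.1 ?_
    rw [fp_written hπ q hy.2]
    change (fpSplit hπ q ((fpSplit hπ q).symm (fpCod hπ q y, v))).1 = _
    rw [ContinuousLinearEquiv.apply_symm_apply]

end Mfd

/-! ### Local triviality from simply transitive fibres -/

namespace IsPrincipalBundle

variable {G : Mfd.{u}} [Group G] [LieGroup (𝓡 G.dim) ∞ G] {P M : Mfd.{u}} {π : P → M}
  {act : P → G → P}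

/-- The orbit maps of a smooth free action of a Lie group are immersions. -/
lemma injective_mfderiv_orbit
    (act_smooth : ContMDiff ((𝓡 P.dim).prod (𝓡 G.dim)) (𝓡 P.dim) ∞
      (fun q : P × G => act q.1 q.2))
    (act_one : ∀ p, act p 1 = p) (act_mul : ∀ p g h, act (act p g) h = act p (g * h))
    (free : ∀ p, Function.Injective (act p)) (p : P) (g : G) :
    Function.Injective (mfderiv (𝓡 G.dim) (𝓡 P.dim) (act p) g) := by
  have hp : Smooth (act p) := act_smooth.comp (contMDiff_const.prodMk contMDiff_id)
  have hR : ∀ a, Smooth (fun q => act q a) := fun a =>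
    act_smooth.comp (contMDiff_id.prodMk contMDiff_const)
  have hr : ∀ a, Smooth (fun h : G => h * a) := fun a => contMDiff_mul_right
  obtain ⟨g₀, hg₀⟩ := exists_injective_mfderiv hp (free p)
  let a := g₀⁻¹ * g
  have hga : g * a⁻¹ = g₀ := by simp [a]
  -- With `a = g₀⁻¹ g`, translations by `a⁻¹` in the group and by `a` in `P` relate the derivative
  -- at `g` to the one at `g₀`.
  have e : act p = (fun q => act q a) ∘ (act p ∘ fun h => h * a⁻¹) := by
    funext h
    simp [act_mul]
  rw [e]
  refine mfderiv_injective_comp ((hR a).contMDiffAt.mdifferentiableAt (by simp))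
    ((hp.comp (hr a⁻¹)).contMDiffAt.mdifferentiableAt (by simp)) ?_ ?_
  · refine mfderiv_injective_of_leftInverse (g := fun q => act q a⁻¹)
      ((hR a⁻¹).contMDiffAt.mdifferentiableAt (by simp))
      ((hR a).contMDiffAt.mdifferentiableAt (by simp)) (Filter.Eventually.of_forall fun q => ?_)
    simp [act_mul, act_one]
  · refine mfderiv_injective_comp (hp.contMDiffAt.mdifferentiableAt (by simp))
      ((hr a⁻¹).contMDiffAt.mdifferentiableAt (by simp)) ?_ ?_
    · rw [hga]
      exact hg₀
    · refine mfderiv_injective_of_leftInverse (g := fun h => h * a)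
        ((hr a).contMDiffAt.mdifferentiableAt (by simp))
        ((hr a⁻¹).contMDiffAt.mdifferentiableAt (by simp))
        (Filter.Eventually.of_forall fun q => ?_)
      simp

/-- A surjective submersion with a smooth action that is simply transitive on the fibres is a
principal bundle. -/
lemma of_submersion (hπ : Submersion π) (hs : Function.Surjective π)
    (act_smooth : ContMDiff ((𝓡 P.dim).prod (𝓡 G.dim)) (𝓡 P.dim) ∞
      (fun q : P × G => act q.1 q.2))
    (act_one : ∀ p, act p 1 = p) (act_mul : ∀ p g h, act (act p g) h = act p (g * h))
    (proj_act : ∀ p g, π (act p g) = π p) (transitive : ∀ p q, π p = π q → ∃! g, act p g = q) :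
    IsPrincipalBundle G π act := by
  have hπs : Smooth π := hπ.contMDiff
  have free : ∀ p, Function.Injective (act p) := fun p g h hgh =>
    (transitive p (act p h) (proj_act p h).symm).unique hgh rfl
  refine of_localDivision hπs act_smooth act_one act_mul proj_act free (fun x₀ => ?_)
  obtain ⟨U, s, hU, hx₀, hsm, hsec⟩ := exists_local_section hπ hs x₀
  -- The division map is chosen pointwise, with value `1` off `π ⁻¹' U`; its smoothness is all that
  -- remains to prove.
  have hd : ∀ p, ∃ g : G, π p ∈ U → act (s (π p)) g = p := fun p => by
    by_cases hp : π p ∈ U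
    · obtain ⟨g, hg, -⟩ := transitive (s (π p)) p (hsec _ hp)
      exact ⟨g, fun _ => hg⟩
    · exact ⟨1, fun h => absurd h hp⟩
  choose d hd using hd
  refine ⟨U, s, d, hx₀, hU, hsm, ?_, hsec, hd⟩
  let Ψ : M × G → P := fun q => act (s q.1) q.2
  let S : Set (M × G) := U ×ˢ Set.univ
  have hS : IsOpen S := hU.prod isOpen_univ
  have hΨ : ContMDiffOn ((𝓡 M.dim).prod (𝓡 G.dim)) (𝓡 P.dim) ∞ Ψ S :=
    act_smooth.comp_contMDiffOn ((hsm.comp contMDiff_fst.contMDiffOn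
      (fun q hq => hq.1)).prodMk contMDiff_snd.contMDiffOn)
  have hΨd : ∀ q ∈ S, MDifferentiableAt ((𝓡 M.dim).prod (𝓡 G.dim)) (𝓡 P.dim) Ψ q := fun q hq =>
    (hΨ.contMDiffAt (hS.mem_nhds hq)).mdifferentiableAt (by simp)
  have hΨi : ∀ q ∈ S, Function.Injective
      (mfderiv ((𝓡 M.dim).prod (𝓡 G.dim)) (𝓡 P.dim) Ψ q) := by
    rintro ⟨y, g⟩ hq
    rw [injective_iff_map_eq_zero]
    rintro ⟨v, w⟩ hvw
    -- Since `π ∘ Ψ` is the first projection, a kernel vector has no component along `M`; the rest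
    -- is tangent to an orbit, where the derivative is injective.
    have h1 : π ∘ Ψ =ᶠ[nhds (y, g)] Prod.fst := by
      filter_upwards [hS.mem_nhds hq] with q hq
      change π (act (s q.1) q.2) = q.1
      rw [proj_act, hsec _ hq.1]
    have h2 : mfderiv ((𝓡 M.dim).prod (𝓡 G.dim)) (𝓡 M.dim) (Prod.fst : M × G → M) (y, g) (v, w) =
        0 := by
      rw [← h1.mfderiv_eq, mfderiv_comp (y, g) (hπs.contMDiffAt.mdifferentiableAt (by simp))
        (hΨd _ hq)]
      have h5 : mfderiv (𝓡 P.dim) (𝓡 M.dim) π (Ψ (y, g))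
          (mfderiv ((𝓡 M.dim).prod (𝓡 G.dim)) (𝓡 P.dim) Ψ (y, g) (v, w)) = 0 := by
        rw [hvw, map_zero]
      exact h5
    rw [mfderiv_fst] at h2
    have hv : v = 0 := h2
    subst hv
    have h3 := injective_mfderiv_orbit act_smooth act_one act_mul free (s y) g
    have h4 : act (s y) = Ψ ∘ fun h => (y, h) := rfl
    rw [h4, mfderiv_comp g (hΨd _ hq) (mdifferentiableAt_const.prodMk mdifferentiableAt_id),
      mfderiv_prod_right] at h3
    have hw : w = 0 := (injective_iff_map_eq_zero _).1 h3 w hvw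
    rw [hw]
    rfl
  intro p hp
  have hp' : (π p, d p) ∈ S := ⟨hp, trivial⟩
  have hΨp : Ψ (π p, d p) = p := hd p hp
  have hdim : Module.finrank ℝ (EuclideanSpace ℝ (Fin M.dim) × EuclideanSpace ℝ (Fin G.dim)) =
      Module.finrank ℝ (EuclideanSpace ℝ (Fin P.dim)) := by
    -- One inequality is immersivity. For the other, the image of `Ψ` contains the nonempty open set
    -- `π ⁻¹' U`, so `Ψ` cannot raise the dimension.
    refine le_antisymm ?_ (not_lt.1 fun hlt => ?_)
    · exact LinearMap.finrank_le_finrank_of_injective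
        (f := (mfderiv ((𝓡 M.dim).prod (𝓡 G.dim)) (𝓡 P.dim) Ψ (π p, d p)).toLinearMap) (hΨi _ hp')
    · have h1 := interior_image_eq_empty_of_finrank_lt hS hΨ hlt
      have h2 : π ⁻¹' U ⊆ interior (Ψ '' S) :=
        interior_maximal (fun r hr => ⟨(π r, d r), ⟨hr, trivial⟩, hd r hr⟩)
          (hU.preimage hπs.continuous)
      rw [h1] at h2
      exact h2 hp
  obtain ⟨k, hk, hkp, hΨk⟩ := exists_contMDiffAt_rightInverse (hΨ.contMDiffAt (hS.mem_nhds hp'))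
    (hΨi _ hp') hdim
  rw [hΨp] at hk hkp hΨk
  refine ContMDiffAt.contMDiffWithinAt
    ((contMDiff_snd.contMDiffAt.comp p hk).congr_of_eventuallyEq ?_)
  filter_upwards [hΨk, hk.continuousAt.preimage_mem_nhds (hkp ▸ hS.mem_nhds hp')] with r hr hkr
  have h1 : π r = (k r).1 := by
    conv_lhs => rw [← hr]
    exact (proj_act _ _).trans (hsec _ hkr.1)
  -- By freeness, the group component of the smooth local inverse `k` of `Ψ` coincides with `d` near
  -- `p`.
  refine free (s (π r)) ?_
  rw [hd r (h1 ▸ hkr.1), h1]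
  exact hr.symm

end IsPrincipalBundle

/-! ### Bundles over the groupoid and generalized homomorphisms to a Lie group -/

variable {G : Mfd.{u}} [Group G] [LieGroup (𝓡 G.dim) ∞ G] {Γ : LieGroupoid.{u}}

/-- The generalized homomorphism to a Lie group given by a principal bundle over a groupoid. -/
def GroupoidBundle.toGeneralizedHom (P : GroupoidBundle G Γ) :
    GeneralizedHom Γ (ofLieGroup G) where
  tot := P.tot
  τ := P.proj
  σ := fun _ => PUnit.unit
  τ_submersion := P.principal.proj_submersion
  τ_surjective := P.principal.proj_surjective
  σ_smooth := contMDiff_const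
  left := P.left
  right :=
    { smul := P.act
      smul_smooth := P.principal.act_smooth.comp (fiberProduct_val _ _)
      proj_smul := fun _ _ _ => rfl
      smul_unit := P.principal.act_one
      smul_mul := fun p g h _ _ => P.principal.act_mul p g h }
  σ_left := fun _ _ _ => rfl
  τ_right := fun p g _ => P.principal.proj_act p g
  smul_comm := fun γ p g h _ => P.smul_act γ p g h
  principal := fun p q hpq => by
    obtain ⟨g, hg⟩ := P.principal.exists_act_eq hpq
    exact ⟨g, ⟨rfl, hg⟩, fun h hh => P.principal.act_injective p (hh.2.trans hg.symm)⟩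

variable (G Γ) in
/-- The functor from principal bundles over a groupoid to generalized homomorphisms. -/
def generalizedHomFunctor : GroupoidBundle G Γ ⥤ GeneralizedHom Γ (ofLieGroup G) where
  obj := GroupoidBundle.toGeneralizedHom
  map f := ⟨f.map, f.smooth, f.proj_map, fun _ => rfl, f.map_smul, fun p g _ => f.map_act p g⟩

instance : (generalizedHomFunctor G Γ).Faithful where
  map_injective h := GroupoidBundle.Hom.ext (congrArg GeneralizedHom.Hom.map h)

instance : (generalizedHomFunctor G Γ).Full where
  map_surjective f := ⟨⟨f.map, f.smooth, f.τ_map, fun p g => f.map_right p g rfl, f.map_left⟩, rfl⟩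

namespace GeneralizedHom

variable (Z : GeneralizedHom Γ (ofLieGroup G))

/-- Over a point any two arrows are composable, so the right action is an ordinary action of `G` and
the composability conditions hold by `rfl`. Local triviality comes from `of_submersion`. -/
lemma isPrincipalBundle : IsPrincipalBundle G Z.τ (fun z (g : G) => Z.right.smul z g) := by
  refine IsPrincipalBundle.of_submersion Z.τ_submersion Z.τ_surjective ?_ Z.right.smul_unit
    (fun p g h => Z.right.smul_mul p g h rfl rfl) (fun p g => Z.τ_right p g rfl) ?_
  · exact Z.right.smul_smooth.comp (fiberProduct_lift Z.σ_smooth (ofLieGroup G).tgt_submersion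
      (h := fun q : Z.tot × (ofLieGroup G).arr => ⟨(q.1, q.2), rfl⟩) (contMDiff_fst.prodMk contMDiff_snd))
  · intro p q hpq
    obtain ⟨g, hg, hu⟩ := Z.principal p q hpq
    exact ⟨g, hg.2, fun h hh => hu h ⟨rfl, hh⟩⟩

/-- The principal bundle over a groupoid given by a generalized homomorphism to a Lie group. -/
def toGroupoidBundle : GroupoidBundle G Γ where
  tot := Z.tot
  proj := Z.τ
  act := fun z g => Z.right.smul z g
  principal := Z.isPrincipalBundle
  left := Z.left
  smul_act := fun γ z g h => Z.smul_comm γ z g h rfl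

/-- A generalized homomorphism to a Lie group is isomorphic to that given by its bundle. -/
def isoToGroupoidBundle : Z.toGroupoidBundle.toGeneralizedHom ≅ Z where
  hom := ⟨id, contMDiff_id, fun _ => rfl, fun _ => rfl, fun _ _ _ => rfl, fun _ _ _ => rfl⟩
  inv := ⟨id, contMDiff_id, fun _ => rfl, fun _ => rfl, fun _ _ _ => rfl, fun _ _ _ => rfl⟩

end GeneralizedHom

instance : (generalizedHomFunctor G Γ).EssSurj where
  mem_essImage Z := ⟨Z.toGroupoidBundle, ⟨Z.isoToGroupoidBundle⟩⟩

instance : (generalizedHomFunctor G Γ).IsEquivalence where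

end LieGroupoids

end

theorem mainTheorem11 (Γ : LieGroupoids.LieGroupoid.{u}) (G : LieGroupoids.Mfd.{u})
    [Group G] [LieGroup (𝓡 G.dim) ∞ G] :
    Nonempty (LieGroupoids.GroupoidBundle G Γ ≌ LieGroupoids.SimplicialBundle G Γ.nerve) ∧
    Nonempty (LieGroupoids.GroupoidBundle G Γ ≌
      LieGroupoids.GeneralizedHom Γ (LieGroupoids.LieGroupoid.ofLieGroup G)) ∧
    Nonempty (LieGroupoids.SimplicialBundle G Γ.nerve ≌
      LieGroupoids.GeneralizedHom Γ (LieGroupoids.LieGroupoid.ofLieGroup G)) := by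
  have e₁ := (LieGroupoids.GroupoidBundle.simplicialFunctor G Γ).asEquivalence
  have e₂ := (LieGroupoids.generalizedHomFunctor G Γ).asEquivalence
  exact ⟨⟨e₁⟩, ⟨e₂⟩, ⟨e₁.symm.trans e₂⟩⟩
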